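/- **Lemma 5.5.** Let $R$ be a field, $c\in M_n(R)$, and let $S:=S_n(c,R)=\{x\in M_n(R)\mid cx=xc\}$ be its centralizer matrix algebra. *Notation.* All modules are finitely generated left modules. The elementary divisors of $c$ are the polynomials $p_j^{k_j}$ ($p_j$ monic irreducible, $k_j\ge 1$) in a decomposition $R^n\cong\bigoplus_j R[x]/(p_j^{k_j})$ of $R^n$ as an $R[x]$-module, where $x$ acts as $c$. Let $\mathcal M_c$ be the set of elementary divisors that are maximal with respect to divisibility. For $f\in R[x]$ let $P_c(f)$ be the set of all integers $i\ge 1$ such that $p^i$ is an elementary divisor of $c$ for some irreducible polynomial $p$ dividing $f$ (so $P_c(f^i)=P_c(f)$ for $i\ge1$). Let $$\mathcal I_c:=\{f\in R[x]\mid f \text{ monic irreducible},\ f^i\in\mathcal M_c \text{ for some } i \text{ with } |P_c(f^i)|\ne\max P_c(f^i)\}.$$ For a finite set $T=\{m_1>m_2>\cdots>m_s\}$ of positive integers let $\mathcal D_T$ be the multiset obtained from $\{\{m_1-m_2,\dots,m_{s-1}-m_s,m_s\}\}$ by removing all $1$'s. Let $L_1,\dots,L_m$ be a complete list of pairwise non-isomorphic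 simple $S$-modules with projective covers $P_1,\dots,P_m$. The Cartan matrix of $S$ is $C=([P_i:L_j])_{1\le i,j\le m}$, where $[P_i:L_j]$ is the number of composition factors of $P_i$ isomorphic to $L_j$; its determinant $\det(C)$ is the Cartan determinant. The global dimension $\operatorname{gldim}S$ is the supremum of the projective dimensions of the finitely generated left $S$-modules. An ideal $J$ of an algebra $A$ is a heredity ideal if $J^2=J$, $J\operatorname{rad}(A)J=0$ and $J$ is projective as a left $A$-module; $A$ is quasi-hereditary if there is a finite chain $0=J_0\subseteq J_1\subseteq\cdots\subseteq J_t=A$ of (two-sided) ideals such that $J_j/J_{j-1}$ is a heredity ideal of $A/J_{j-1}$ for $1\le j\le t$. *Then:* (1) $$\det(C)=\begin{cases}\displaystyle\prod_{f\in\mathcal I_c}\ \prod_{i\in\mathcal D_{P_c(f)}} i, & \text{if } \mathcal I_c\neq\emptyset,\\ 1, & \text{if } \mathcal I_c=\emptyset,\end{cases}$$ where the inner product is taken with multiplicities. (2) The following are equivalent: (i) $S$ is quasi-hereditary; (ii) $\operatorname{gldim}S<\infty$; (iii) $\operatorname{gldim}S\le 2$; (iv) $\mathcal I_c=\emptyset$;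 (v) $|P_c(f)|=\max P_c(f)$ for all $f\in\mathcal M_c$; (vi) $\det(C)=1$. -/

import Mathlib

universe u v w

open Polynomial

namespace CentralizerAlg

/-! ### Homological notions for a ring `Λ` (all modules are left modules) -/

section Rings

/-- The global dimension: supremum of the projective dimensions of the finitely generated
left modules. -/
noncomputable def globalDimension (Λ : Type u) [Ring Λ] : WithBot ℕ∞ :=
  ⨆ (M : ModuleCat.{u} Λ) (_ : Module.Finite Λ M), CategoryTheory.projectiveDimension M

/-- A heredity ideal: a two-sided ideal `J` with `J² = J`, `J · rad(Λ) · J = 0` and `J` projective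
as a left module. -/
structure IsHeredityIdeal {Λ : Type u} [Ring Λ] (J : Ideal Λ) : Prop where
  twoSided : J.IsTwoSided
  idempotent : J * J = J
  mul_rad_mul : J * Ring.jacobson Λ * J = ⊥
  projective : Module.Projective Λ J

/-- `Λ` is quasi-hereditary: there is a chain `0 = J₀ ⊆ J₁ ⊆ ⋯ ⊆ Jₘ = Λ` of two-sided ideals such
that `Jᵢ₊₁ / Jᵢ` is a heredity ideal of `Λ / Jᵢ` for all `i < m`. -/
def IsQuasiHereditary (Λ : Type u) [Ring Λ] : Prop :=
  ∃ (m : ℕ) (J : ℕ → Ideal Λ) (_ : ∀ i, (J i).IsTwoSided),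
    Monotone J ∧ J 0 = ⊥ ∧ J m = ⊤ ∧
      ∀ i < m, IsHeredityIdeal ((J (i + 1)).map (Ideal.Quotient.mk (J i)))

/-- `π : P → T` is a projective cover: `P` is projective, `π` is onto, and `ker π` is a
superfluous submodule of `P`. -/
structure IsProjectiveCover {Λ : Type u} [Ring Λ] {P : Type v} {T : Type w} [AddCommGroup P]
    [Module Λ P] [AddCommGroup T] [Module Λ T] (π : P →ₗ[Λ] T) : Prop where
  projective : Module.Projective Λ P
  surjective : Function.Surjective π
  superfluous : ∀ N : Submodule Λ P, N ⊔ LinearMap.ker π = ⊤ → N = ⊤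

/-- `[M : T] = k`: the number of factors isomorphic to `T` in a composition series of `M` is `k`
(by Jordan–Hölder this does not depend on the series). -/
def HasMultiplicity (Λ : Type u) [Ring Λ] (M : Type v) (T : Type w) [AddCommGroup M] [Module Λ M]
    [AddCommGroup T] [Module Λ T] (k : ℕ) : Prop :=
  ∃ s : CompositionSeries (Submodule Λ M), s.head = ⊥ ∧ s.last = ⊤ ∧
    k = Nat.card {i : Fin s.length //
      Nonempty ((s i.succ ⧸ (s i.castSucc).submoduleOf (s i.succ)) ≃ₗ[Λ] T)}

/-- `C` is a Cartan matrix of `Λ`: there are a complete list `T₁, …, Tₘ` of pairwise non-isomorphic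
simple modules and projective covers `Pᵢ → Tᵢ` such that `C i j = [Pᵢ : Tⱼ]`. (It is unique up to
a simultaneous permutation of rows and columns.) -/
def IsCartanMatrix (Λ : Type u) [Ring Λ] {m : ℕ} (C : Matrix (Fin m) (Fin m) ℕ) : Prop :=
  ∃ (T P : Fin m → ModuleCat.{u} Λ) (π : ∀ i, P i →ₗ[Λ] T i),
    (∀ i, IsSimpleModule Λ (T i)) ∧
    (∀ i j, Nonempty (T i ≃ₗ[Λ] T j) → i = j) ∧
    (∀ X : ModuleCat.{u} Λ, IsSimpleModule Λ X → ∃ i, Nonempty (X ≃ₗ[Λ] T i)) ∧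
    (∀ i, IsProjectiveCover (π i)) ∧
    ∀ i j, HasMultiplicity Λ (P i) (T j) (C i j)

/-- Simple modules over an artinian ring have projective covers. -/
theorem exists_projectiveCover (Λ : Type u) [Ring Λ] [IsArtinianRing Λ] (T : Type u)
    [AddCommGroup T] [Module Λ T] [IsSimpleModule Λ T] :
    ∃ (L : Submodule Λ Λ) (π : L →ₗ[Λ] T), IsProjectiveCover π := by
  have : Nontrivial T := IsSimpleModule.nontrivial Λ T
  obtain ⟨t, ht⟩ := exists_ne (0 : T)
  let f : Λ →ₗ[Λ] T := LinearMap.toSpanSingleton Λ T t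
  have hf : Function.Surjective f := IsSimpleModule.toSpanSingleton_surjective Λ ht
  obtain ⟨L, hL, hmin⟩ := (wellFounded_lt (α := Submodule Λ Λ)).has_min
    {L | L.map f = ⊤} ⟨⊤, by simpa [LinearMap.range_eq_top] using hf⟩
  have hmin' : ∀ N : Submodule Λ L, (N.map (f ∘ₗ L.subtype)) = ⊤ → N = ⊤ := by
    intro N hN
    rw [Submodule.map_comp] at hN
    have h1 : N.map L.subtype ≤ L := Submodule.map_subtype_le L N
    have h2 := hmin (N.map L.subtype) hN
    have h3 : N.map L.subtype = L := by
      by_contra hne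
      exact h2 (lt_of_le_of_ne h1 hne)
    apply Submodule.map_injective_of_injective L.injective_subtype
    rw [h3]; simp
  have hsurj : Function.Surjective (f ∘ₗ L.subtype) := by
    rw [← LinearMap.range_eq_top, LinearMap.range_comp, Submodule.range_subtype]; exact hL
  obtain ⟨g, hg⟩ := Module.projective_lifting_property (f ∘ₗ L.subtype) f hsurj
  have hgs : Function.Surjective (g ∘ₗ L.subtype) := by
    rw [← LinearMap.range_eq_top]
    apply hmin'
    rw [← LinearMap.range_comp, ← LinearMap.comp_assoc, hg, LinearMap.range_eq_top]
    exact hsurj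
  have hgi : Function.Injective (g ∘ₗ L.subtype) :=
    IsNoetherian.injective_of_surjective_endomorphism _ hgs
  let e : L ≃ₗ[Λ] L := LinearEquiv.ofBijective (g ∘ₗ L.subtype) ⟨hgi, hgs⟩
  refine ⟨L, f ∘ₗ L.subtype, ?_, hsurj, ?_⟩
  · refine Module.Projective.of_split L.subtype (e.symm.toLinearMap ∘ₗ g) ?_
    ext x
    have : e.symm (g x) = x := by
      rw [LinearEquiv.symm_apply_eq]; rfl
    simp [this]
  · intro N hN
    apply hmin'
    have h := congrArg (Submodule.map (f ∘ₗ L.subtype)) hN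
    rw [Submodule.map_sup, Submodule.map_top, LinearMap.range_eq_top.2 hsurj] at h
    rw [← h, eq_comm, sup_eq_left, Submodule.map_le_iff_le_comap]
    intro x hx
    simp only [Submodule.mem_comap, LinearMap.mem_ker.1 hx, Submodule.zero_mem]

/-- Every simple module is a factor of any composition series of the regular module. -/
theorem exists_factor (Λ : Type u) [Ring Λ] (s : CompositionSeries (Submodule Λ Λ))
    (h0 : s.head = ⊥) (h1 : s.last = ⊤) (T : Type u) [AddCommGroup T] [Module Λ T]
    [IsSimpleModule Λ T] :
    ∃ i : Fin s.length,
      Nonempty (T ≃ₗ[Λ] (s i.succ ⧸ (s i.castSucc).submoduleOf (s i.succ))) := by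
  have : Nontrivial T := IsSimpleModule.nontrivial Λ T
  obtain ⟨t, ht⟩ := exists_ne (0 : T)
  let f : Λ →ₗ[Λ] T := LinearMap.toSpanSingleton Λ T t
  have hf : Function.Surjective f := IsSimpleModule.toSpanSingleton_surjective Λ ht
  have hex : ∃ i : Fin s.length, s i.castSucc ≤ LinearMap.ker f ∧ ¬ s i.succ ≤ LinearMap.ker f := by
    by_contra hcon
    push Not at hcon
    have hall : ∀ i : Fin (s.length + 1), s i ≤ LinearMap.ker f := by
      intro i
      induction i using Fin.induction with
      | zero => exact (le_of_eq h0).trans bot_le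
      | succ i ih => exact hcon i ih
    have := hall (Fin.last _)
    have h1' : s (Fin.last _) = ⊤ := h1
    rw [h1', top_le_iff, LinearMap.ker_eq_top] at this
    obtain ⟨x, hx⟩ := hf t
    rw [this] at hx
    exact ht hx.symm
  obtain ⟨i, hi, hi'⟩ := hex
  have hcov : s i.castSucc ⋖ s i.succ := s.step i
  have : IsSimpleModule Λ (s i.succ ⧸ (s i.castSucc).submoduleOf (s i.succ)) :=
    (covBy_iff_quot_is_simple hcov.le).mp hcov
  let q : (s i.succ ⧸ (s i.castSucc).submoduleOf (s i.succ)) →ₗ[Λ] T :=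
    Submodule.liftQ _ (f ∘ₗ (s i.succ).subtype) (by
      intro x hx
      exact hi hx)
  have hq : q ≠ 0 := by
    intro hq
    apply hi'
    intro x hx
    have h := LinearMap.congr_fun hq (Submodule.Quotient.mk ⟨x, hx⟩)
    exact h
  exact ⟨i, ⟨(LinearEquiv.ofBijective q (LinearMap.bijective_of_ne_zero hq)).symm⟩⟩

/-- Every artinian ring has a Cartan matrix. -/
theorem exists_isCartanMatrix (Λ : Type u) [Ring Λ] [IsArtinianRing Λ] :
    ∃ (m : ℕ) (C : Matrix (Fin m) (Fin m) ℕ), IsCartanMatrix Λ C := by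
  classical
  obtain ⟨s, h0, h1⟩ := exists_compositionSeries_of_isNoetherian_isArtinian Λ Λ
  let F : Fin s.length → ModuleCat.{u} Λ := fun i ↦
    ModuleCat.of Λ (s i.succ ⧸ (s i.castSucc).submoduleOf (s i.succ))
  have hF : ∀ i, IsSimpleModule Λ (F i) := fun i ↦
    (covBy_iff_quot_is_simple (s.step i).le).mp (s.step i)
  let r : Setoid (Fin s.length) :=
    { r := fun i j ↦ Nonempty (F i ≃ₗ[Λ] F j)
      iseqv := ⟨fun i ↦ ⟨.refl _ _⟩, fun ⟨e⟩ ↦ ⟨e.symm⟩, fun ⟨e⟩ ⟨e'⟩ ↦ ⟨e.trans e'⟩⟩ }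
  let e : Quotient r ≃ Fin (Fintype.card (Quotient r)) := Fintype.equivFin _
  let T : Fin (Fintype.card (Quotient r)) → ModuleCat.{u} Λ := fun i ↦ F (e.symm i).out
  have hT : ∀ i, IsSimpleModule Λ (T i) := fun i ↦ hF _
  choose L π hπ using fun i ↦ exists_projectiveCover Λ (T i)
  have hmult : ∀ i j, ∃ k, HasMultiplicity Λ (L i) (T j) k := by
    intro i j
    obtain ⟨s', h0', h1'⟩ := exists_compositionSeries_of_isNoetherian_isArtinian Λ (L i)
    exact ⟨_, s', h0', h1', rfl⟩
  choose C hC using hmult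
  refine ⟨_, Matrix.of C, T, fun i ↦ ModuleCat.of Λ (L i), π, hT, ?_, ?_, hπ, hC⟩
  · intro i j hij
    apply e.symm.injective
    rw [← Quotient.out_eq (e.symm i), ← Quotient.out_eq (e.symm j)]
    exact Quotient.sound hij
  · intro X hX
    obtain ⟨i, ⟨g⟩⟩ := exists_factor Λ s h0 h1 X
    have : Nonempty (F i ≃ₗ[Λ] T (e ⟦i⟧)) := by
      have h : r.r (Quotient.out (e.symm (e (⟦i⟧ : Quotient r)))) i := by
        rw [Equiv.symm_apply_apply]
        exact Quotient.mk_out i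
      exact r.iseqv.symm h
    obtain ⟨g'⟩ := this
    exact ⟨_, ⟨g.trans g'⟩⟩

end Rings

/-! ### Combinatorics of finite sets of positive integers -/

/-- For `T = {m₁ > ⋯ > mₛ}` the multiset `H_T = {{m₁ - m₂, …, mₛ₋₁ - mₛ, mₛ}}`. -/
def gaps (T : Finset ℕ) : Multiset ℕ :=
  let l := T.sort (· ≥ ·)
  (List.zipWith (· - ·) l (l.tail ++ [0]) : List ℕ)

/-- The multiset `D_T`, obtained from `H_T` by removing all `1`s. -/
def nontrivialGaps (T : Finset ℕ) : Multiset ℕ :=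
  (gaps T).filter (· ≠ 1)

/-! ### Elementary divisors -/

section Matrices

variable {R : Type u} [Field R] {n : ℕ}

/-- The centralizer matrix algebra `S_n(c, R) = {x ∈ M_n(R) | c x = x c}`. -/
abbrev centralizerAlgebra (c : Matrix (Fin n) (Fin n) R) :
    Subalgebra R (Matrix (Fin n) (Fin n) R) :=
  Subalgebra.centralizer R {c}

/-- The centralizer matrix algebra is finite-dimensional, so it has a Cartan matrix. -/
theorem exists_isCartanMatrix_centralizerAlgebra (c : Matrix (Fin n) (Fin n) R) :
    ∃ (m : ℕ) (C : Matrix (Fin m) (Fin m) ℕ), IsCartanMatrix (centralizerAlgebra c) C := by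
  have : IsArtinianRing (centralizerAlgebra c) := IsArtinianRing.of_finite R _
  exact exists_isCartanMatrix _

/-- `E` is the multiset of elementary divisors of `c`: it consists of powers `pᵢ ^ kᵢ` (`kᵢ ≥ 1`) of
monic irreducible polynomials, and `Rⁿ`, with `x` acting as `c`, is isomorphic as an `R[x]`-module
to the direct sum of the `R[x] / (pᵢ ^ kᵢ)`. -/
def HasElementaryDivisors (c : Matrix (Fin n) (Fin n) R) (E : Multiset R[X]) : Prop :=
  ∃ (r : ℕ) (p : Fin r → R[X]) (k : Fin r → ℕ),
    (∀ i, (p i).Monic ∧ Irreducible (p i) ∧ 1 ≤ k i) ∧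
    Nonempty (Module.AEval' (Matrix.toLin' c) ≃ₗ[R[X]]
      ((i : Fin r) → R[X] ⧸ Ideal.span {p i ^ k i})) ∧
    E = Finset.univ.val.map fun i ↦ p i ^ k i

theorem exists_hasElementaryDivisors (c : Matrix (Fin n) (Fin n) R) :
    ∃ E, HasElementaryDivisors c E := by
  classical
  obtain ⟨ι, _, p, hp, e, ⟨f⟩⟩ := Module.equiv_directSum_of_isTorsion
    (Module.AEval.isTorsion_of_finiteDimensional R (Fin n → R) (Matrix.toLin' c))
  let κ := {i : ι // 1 ≤ e i}
  have hspan : ∀ i : ι, Ideal.span {p i ^ e i} = Ideal.span {normalize (p i) ^ e i} := fun i ↦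
    Ideal.span_singleton_eq_span_singleton.2 ((normalize_associated (p i)).symm.pow_pow)
  let f₁ : Module.AEval' (Matrix.toLin' c) ≃ₗ[R[X]]
      ((i : ι) → R[X] ⧸ Ideal.span {normalize (p i) ^ e i}) :=
    (f.trans (DirectSum.linearEquivFunOnFintype _ _ _)).trans
      (LinearEquiv.piCongrRight fun i ↦ Submodule.quotEquivOfEq _ _ (hspan i))
  let g : ((i : ι) → R[X] ⧸ Ideal.span {normalize (p i) ^ e i}) →ₗ[R[X]]
      ((i : κ) → R[X] ⧸ Ideal.span {normalize (p i) ^ e i}) :=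
    LinearMap.pi fun i ↦ LinearMap.proj i.1
  have hg : Function.Bijective g := by
    constructor
    · intro x y hxy
      funext i
      by_cases hi : 1 ≤ e i
      · exact congrFun hxy ⟨i, hi⟩
      · have h0 : e i = 0 := by omega
        have : Subsingleton (R[X] ⧸ Ideal.span {normalize (p i) ^ e i}) := by
          rw [Ideal.Quotient.subsingleton_iff, h0, pow_zero, Ideal.span_singleton_one]
        exact Subsingleton.elim _ _
    · intro y
      refine ⟨fun i ↦ if h : 1 ≤ e i then y ⟨i, h⟩ else 0, ?_⟩
      funext i
      exact dif_pos i.2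
  let σ : Fin (Fintype.card κ) ≃ κ := (Fintype.equivFin κ).symm
  let f₂ := f₁.trans (LinearEquiv.ofBijective g hg)
  let f₃ : ((i : κ) → R[X] ⧸ Ideal.span {normalize (p i) ^ e i}) ≃ₗ[R[X]]
      ((j : Fin (Fintype.card κ)) → R[X] ⧸ Ideal.span {normalize (p (σ j)) ^ e (σ j)}) :=
    (LinearEquiv.piCongrLeft R[X]
      (fun i : κ ↦ R[X] ⧸ Ideal.span {normalize (p i) ^ e i}) σ).symm
  exact ⟨_, _, fun j ↦ normalize (p (σ j)), fun j ↦ e (σ j),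
    fun j ↦ ⟨monic_normalize (hp _).ne_zero, (normalize_associated _).irreducible_iff.2 (hp _),
      (σ j).2⟩, ⟨f₂.trans f₃⟩, rfl⟩

/-- The multiset of elementary divisors of `c` (unique by the structure theorem for modules over
the principal ideal domain `R[x]`). -/
noncomputable def elementaryDivisors (c : Matrix (Fin n) (Fin n) R) : Multiset R[X] :=
  (exists_hasElementaryDivisors c).choose

theorem hasElementaryDivisors (c : Matrix (Fin n) (Fin n) R) :
    HasElementaryDivisors c (elementaryDivisors c) :=
  (exists_hasElementaryDivisors c).choose_spec

theorem ne_zero_of_mem {c : Matrix (Fin n) (Fin n) R} {h : R[X]}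
    (hh : h ∈ elementaryDivisors c) : h ≠ 0 := by
  obtain ⟨r, p, k, hp, -, hE⟩ := hasElementaryDivisors c
  rw [hE, Multiset.mem_map] at hh
  obtain ⟨i, -, rfl⟩ := hh
  exact pow_ne_zero _ (hp i).2.1.ne_zero

/-- The maximal elementary divisors `M_c`: those maximal with respect to divisibility. -/
def maximalDivisors (c : Matrix (Fin n) (Fin n) R) : Set R[X] :=
  {f | f ∈ elementaryDivisors c ∧ ∀ g ∈ elementaryDivisors c, f ∣ g → g = f}

theorem finite_powerIndices (c : Matrix (Fin n) (Fin n) R) (f : R[X]) :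
    {i : ℕ | 1 ≤ i ∧ ∃ p : R[X], Irreducible p ∧ p ∣ f ∧ p ^ i ∈ elementaryDivisors c}.Finite := by
  classical
  refine (Set.finite_Iic (((elementaryDivisors c).map natDegree).sum)).subset ?_
  rintro i ⟨-, p, hp, -, hi⟩
  have h1 : (p ^ i).natDegree ≤ ((elementaryDivisors c).map natDegree).sum :=
    Multiset.single_le_sum (fun _ _ ↦ Nat.zero_le _) _ (Multiset.mem_map_of_mem _ hi)
  rw [natDegree_pow] at h1
  exact (Nat.le_mul_of_pos_right i hp.natDegree_pos).trans h1

/-- The set `P_c(f)` of power indices: all `i ≥ 1` such that `p ^ i` is an elementary divisor of `c`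
for some irreducible `p` dividing `f`. -/
noncomputable def powerIndices (c : Matrix (Fin n) (Fin n) R) (f : R[X]) : Finset ℕ :=
  (finite_powerIndices c f).toFinset

/-- For irreducible `f`, the set `P_c(f)` is by convention `P_c(f ^ i)` if `f ^ i` is a maximal
elementary divisor; this is what the definition gives at `f`. -/
theorem powerIndices_pow (c : Matrix (Fin n) (Fin n) R) (f : R[X]) {i : ℕ} (hi : i ≠ 0) :
    powerIndices c (f ^ i) = powerIndices c f := by
  ext j
  simp only [powerIndices, Set.Finite.mem_toFinset, Set.mem_ofPred_eq]
  constructor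
  · rintro ⟨hj, p, hp, hd, he⟩
    exact ⟨hj, p, hp, hp.prime.dvd_of_dvd_pow hd, he⟩
  · rintro ⟨hj, p, hp, hd, he⟩
    exact ⟨hj, p, hp, hd.trans (dvd_pow_self f hi), he⟩

/-- The set `I_c` of monic irreducible polynomials `f` such that some power `f ^ i` is a maximal
elementary divisor with `|P_c(f ^ i)| ≠ max P_c(f ^ i)`. -/
def irregularFactors (c : Matrix (Fin n) (Fin n) R) : Set R[X] :=
  {f | f.Monic ∧ Irreducible f ∧ ∃ i : ℕ, f ^ i ∈ maximalDivisors c ∧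
    (powerIndices c (f ^ i)).card ≠ (powerIndices c (f ^ i)).sup id}

theorem finite_irregularFactors (c : Matrix (Fin n) (Fin n) R) : (irregularFactors c).Finite := by
  classical
  refine (Finset.finite_toSet ((elementaryDivisors c).toFinset.biUnion
    fun h ↦ (UniqueFactorizationMonoid.normalizedFactors h).toFinset)).subset ?_
  rintro f ⟨hm, hf, i, ⟨hi, -⟩, -⟩
  have h0 : i ≠ 0 := by
    rintro rfl
    obtain ⟨r, p, k, hp, -, hE⟩ := hasElementaryDivisors c
    rw [hE, Multiset.mem_map] at hi
    obtain ⟨j, -, hj⟩ := hi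
    rw [pow_zero] at hj
    exact (hp j).2.1.not_isUnit ((isUnit_pow_iff (by have := (hp j).2.2; omega)).1 (hj ▸ isUnit_one))
  simp only [Finset.coe_biUnion, Set.mem_iUnion, Finset.mem_coe, Multiset.mem_toFinset]
  refine ⟨f ^ i, hi, ?_⟩
  rw [UniqueFactorizationMonoid.mem_normalizedFactors_iff' (ne_zero_of_mem hi)]
  exact ⟨hf, hm.normalize_eq_self, dvd_pow_self f h0⟩

end Matrices

end CentralizerAlg

open CentralizerAlg

/-!
The centralizer of `c` is the endomorphism algebra `Λ` of the `R[X]`-module `V = Rⁿ`, which is a sum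
of primary cyclic modules `A / p ^ k` over `A = R[X]`. Everything is proved for such endomorphism
algebras over a principal ideal domain `A`.

*Cartan determinant.* The idempotents `e j` of `Λ` belonging to the summands of `V` satisfy
`e j Λ e j = A e j`. Hence `e j T` is zero or simple over `A` for every simple module `T`, exactly
one `T` has `e j T ≠ 0`, its projective cover is `Λ e j`, and multiplicities are lengths of `e j X`
over `A`. The Cartan numbers are therefore the lengths of the `Hom (A / p ^ a, A / q ^ b)`, which
are `min a b` for `p = q` and `0` otherwise (`exists_index_of_isCartanMatrix`). The matrix
`(min a b)` indexed by a finite set `T` factors as `Z D Zᵀ`, where `Z` is unitriangular and `D` is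
the diagonal matrix of the gaps of `T` (`det_min_eq`).

*Finite global dimension implies determinant one.* The dimension vectors of the simple modules are
then integral combinations of the rows of the Cartan matrix, so the determinant, which is positive,
is a unit (`isUnit_det_of_globalDimension_lt_top`). As the determinant is a product of gaps, it is
one if and only if there are no gaps different from one.

*No gaps implies global dimension at most two.* A second syzygy has the form `Hom (D, V)` with `D`
annihilated by the annihilator of `V`. If every prime power dividing an elementary divisor is itself
an elementary divisor, then such a `D` is a direct summand of a power of `V`, and `Hom (D, V)` is
projective (`globalDimension_le_two_of_forall_associated`).

*No gaps implies quasi-hereditary.* Let `χ = q₁ ⋯ qₘ` be the minimal polynomial, factored into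
primes. The elements of `Λ` killed by `q₁ ⋯ qᵢ` form a heredity chain: with `d = q₁ ⋯ qᵢ₋₁`, the
quotient of `Λ` by the elements killed by `d` is the endomorphism algebra of `d V`, and the
endomorphisms of `d V` killed by `qᵢ` are those that factor through powers of its direct summand
`A / qᵢ` (`isQuasiHereditary_of_forall_associated`).

*Quasi-hereditary implies no gaps.* If the exponent `t` is missing for the prime `p` while a larger
one occurs, then every element of the `p`-primary part of `p ^ (t - 1) V` killed by `p` is divisible
by `p` in it. This forces every ideal of a heredity chain to annihilate that module
(`algebraMap_eq_zero_of_isQuasiHereditary`, `not_isQuasiHereditary_of_gap`).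
-/

namespace CentralizerAlg

/-! ### Gaps of finite sets and determinants of min-matrices -/

/-- The gap below `t` in `T`: the difference between `t` and the largest element of `T` smaller
than `t`, where the latter is read as `0` if there is none. -/
def gapBelow (T : Finset ℕ) (t : ℕ) : ℕ := t - (T.filter (· < t)).sup id

theorem gapBelow_insert_of_lt {T : Finset ℕ} {m t : ℕ} (h : t ≤ m) :
    gapBelow (insert m T) t = gapBelow T t := by
  unfold gapBelow
  rw [Finset.filter_insert, if_neg (by omega)]

theorem gapBelow_insert_self {T : Finset ℕ} {m : ℕ} (h : ∀ x ∈ T, x < m) :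
    gapBelow (insert m T) m = m - T.sup id := by
  unfold gapBelow
  rw [Finset.filter_insert, if_neg (lt_irrefl m), Finset.filter_true_of_mem h]

theorem sup_insert_of_lt {T : Finset ℕ} {m : ℕ} (h : ∀ x ∈ T, x < m) :
    (insert m T).sup id = m := by
  rw [Finset.sup_insert]
  exact max_eq_left (Finset.sup_le fun x hx ↦ (h x hx).le)

theorem sum_gapBelow (T : Finset ℕ) : ∑ t ∈ T, gapBelow T t = T.sup id := by
  induction T using Finset.induction_on_max with
  | empty => simp
  | insert m T hT ih =>
    have hm : m ∉ T := fun h ↦ lt_irrefl _ (hT m h)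
    rw [Finset.sum_insert hm, gapBelow_insert_self hT, sup_insert_of_lt hT,
      Finset.sum_congr rfl fun t ht ↦ gapBelow_insert_of_lt (hT t ht).le, ih]
    exact Nat.sub_add_cancel (Finset.sup_le fun x hx ↦ (hT x hx).le)

theorem gapBelow_pos {T : Finset ℕ} {t : ℕ} (ht : 0 < t) : 0 < gapBelow T t := by
  unfold gapBelow
  refine Nat.sub_pos_of_lt ((Finset.sup_lt_iff (by simpa using ht)).2 ?_)
  intro x hx
  exact (Finset.mem_filter.1 hx).2

theorem sum_gapBelow_le {T : Finset ℕ} {a : ℕ} (ha : a ∈ T) :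
    ∑ t ∈ T with t ≤ a, gapBelow T t = a := by
  have h : ∀ t ∈ T.filter (· ≤ a), gapBelow T t = gapBelow (T.filter (· ≤ a)) t := by
    intro t ht
    unfold gapBelow
    rw [Finset.filter_filter]
    congr 2
    ext x
    have := (Finset.mem_filter.1 ht).2
    simp only [Finset.mem_filter]
    exact ⟨fun hx ↦ ⟨hx.1, by omega, hx.2⟩, fun hx ↦ ⟨hx.1, hx.2.2⟩⟩
  rw [Finset.sum_congr rfl h, sum_gapBelow]
  refine le_antisymm (Finset.sup_le fun x hx ↦ (Finset.mem_filter.1 hx).2) ?_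
  exact Finset.le_sup (f := id) (Finset.mem_filter.2 ⟨ha, le_rfl⟩)

theorem zipWith_sub_tail (l : List ℕ) (hl : l.Pairwise (· > ·)) :
    List.zipWith (· - ·) l (l.tail ++ [0]) = l.map (gapBelow l.toFinset) := by
  induction l with
  | nil => rfl
  | cons a l ih =>
    rw [List.pairwise_cons] at hl
    have hlt : ∀ x ∈ l.toFinset, x < a := fun x hx ↦ hl.1 x (List.mem_toFinset.1 hx)
    have ih := ih hl.2
    rw [List.map_cons, List.toFinset_cons, gapBelow_insert_self hlt,
      List.map_congr_left (g := gapBelow l.toFinset)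
        fun t ht ↦ gapBelow_insert_of_lt (hl.1 t ht).le, ← ih]
    cases l with
    | nil => simp
    | cons b l =>
      have hb : ∀ x ∈ l.toFinset, x < b := fun x hx ↦
        (List.pairwise_cons.1 hl.2).1 x (List.mem_toFinset.1 hx)
      rw [List.toFinset_cons, sup_insert_of_lt hb]
      rfl

theorem gaps_eq_map (T : Finset ℕ) : gaps T = T.val.map (gapBelow T) := by
  have hs : (T.sort (· ≥ ·)).Pairwise (· > ·) := T.sortedGT_sort.pairwise
  have h := zipWith_sub_tail _ hs
  rw [Finset.sort_toFinset] at h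
  have : gaps T = ((T.sort (· ≥ ·)).map (gapBelow T) : List ℕ) := congrArg _ h
  rw [this, ← Multiset.map_coe, Finset.sort_eq]

theorem prod_nontrivialGaps (T : Finset ℕ) :
    (nontrivialGaps T).prod = ∏ t ∈ T, gapBelow T t := by
  have h : ∀ s : Multiset ℕ, (s.filter (· ≠ 1)).prod = s.prod := by
    intro s
    induction s using Multiset.induction_on with
    | empty => simp
    | cons a s ih =>
      by_cases ha : a = 1
      · simpa [ha] using ih
      · rw [Multiset.filter_cons_of_pos (p := (· ≠ 1)) s ha, Multiset.prod_cons, Multiset.prod_cons, ih]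
  rw [nontrivialGaps, h, gaps_eq_map]
  rfl

/-- The gaps of `T` are positive and add up to `max T`, so they are all equal to `1` exactly if
`|T| = max T`. -/
theorem prod_nontrivialGaps_eq_one_iff {T : Finset ℕ} (hT : ∀ t ∈ T, 0 < t) :
    (nontrivialGaps T).prod = 1 ↔ T.card = T.sup id := by
  rw [prod_nontrivialGaps, Finset.prod_eq_one_iff, ← sum_gapBelow, Finset.card_eq_sum_ones,
    Finset.sum_eq_sum_iff_of_le fun t ht ↦ gapBelow_pos (hT t ht)]
  exact forall₂_congr fun _ _ ↦ eq_comm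

theorem prod_nontrivialGaps_pos {T : Finset ℕ} (hT : ∀ t ∈ T, 0 < t) :
    0 < (nontrivialGaps T).prod := by
  rw [prod_nontrivialGaps]
  exact Finset.prod_pos fun t ht ↦ gapBelow_pos (hT t ht)

/-- A set of `s` positive integers with maximum `s` is the whole interval `{1, …, s}`. -/
theorem eq_Icc_of_card_eq_sup {T : Finset ℕ} (hT : ∀ t ∈ T, 0 < t) (h : T.card = T.sup id) :
    T = Finset.Icc 1 (T.sup id) := by
  refine Finset.eq_of_subset_of_card_le (fun t ht ↦ ?_) ?_
  · exact Finset.mem_Icc.2 ⟨hT t ht, Finset.le_sup (f := id) ht⟩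
  · simp [h]

theorem exists_gap_of_card_ne_sup {T : Finset ℕ} (hT : ∀ t ∈ T, 0 < t)
    (h : T.card ≠ T.sup id) : ∃ t, 0 < t ∧ t ∉ T ∧ ∃ k ∈ T, t < k := by
  have hne : T.Nonempty := by
    rw [Finset.nonempty_iff_ne_empty]
    rintro rfl
    simp at h
  have hs : T ⊆ Finset.Icc 1 (T.sup id) := fun t ht ↦
    Finset.mem_Icc.2 ⟨hT t ht, Finset.le_sup (f := id) ht⟩
  obtain ⟨t, ht, htT⟩ : ∃ t ∈ Finset.Icc 1 (T.sup id), t ∉ T := by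
    by_contra! hcon
    exact h (by conv_lhs => rw [hs.antisymm hcon]
                simp)
  obtain ⟨k, hk, hks⟩ := Finset.exists_mem_eq_sup T hne id
  rw [Finset.mem_Icc] at ht
  refine ⟨t, by omega, htT, k, hk, lt_of_le_of_ne (by rw [hks] at ht; exact ht.2) ?_⟩
  rintro rfl
  exact htT hk

/-- The matrix `(min a b)` indexed by `T` factors as `Z D Zᵀ`, where `D` is the diagonal matrix of
the gaps and `Z`, with entries `[t ≤ a]`, is unitriangular. -/
theorem det_min_eq (T : Finset ℕ) :
    (Matrix.of fun a b : T ↦ ((min a.1 b.1 : ℕ) : ℤ)).det = ((nontrivialGaps T).prod : ℤ) := by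
  let Z : Matrix T T ℤ := Matrix.of fun a t ↦ if t.1 ≤ a.1 then 1 else 0
  have hZ : Z.det = 1 := by
    rw [Matrix.det_of_isLowerTriangular]
    · simp [Z]
    · intro a b hab
      have : a < b := hab
      exact if_neg (not_le.2 this)
  have hM : (Matrix.of fun a b : T ↦ ((min a.1 b.1 : ℕ) : ℤ)) =
      Z * Matrix.diagonal (fun t ↦ (gapBelow T t.1 : ℤ)) * Z.transpose := by
    ext a b
    rw [Matrix.mul_apply]
    simp only [Matrix.mul_diagonal, Matrix.transpose_apply, Z, Matrix.of_apply]
    have hmin : min a.1 b.1 ∈ T := by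
      rcases min_choice a.1 b.1 with h | h <;> rw [h]
      exacts [a.2, b.2]
    rw [← sum_gapBelow_le hmin, Finset.sum_filter, ← Finset.sum_coe_sort T, Nat.cast_sum]
    refine Finset.sum_congr rfl fun t _ ↦ ?_
    by_cases h1 : t.1 ≤ a.1 <;> by_cases h2 : t.1 ≤ b.1 <;> simp [h1, h2]
  rw [hM, Matrix.det_mul, Matrix.det_mul, Matrix.det_transpose, hZ, Matrix.det_diagonal,
    prod_nontrivialGaps, ← Finset.prod_coe_sort T]
  simp

/-! ### Quasi-hereditary algebras: a necessary condition -/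

theorem mem_ringJacobson_of_isNilpotent_of_commute {Λ : Type*} [Ring Λ] {z : Λ}
    (hz : IsNilpotent z) (hc : ∀ x, Commute x z) : z ∈ Ring.jacobson Λ := by
  rw [← Ideal.jacobson_bot, Ideal.mem_jacobson_iff]
  intro y
  obtain ⟨u, hu⟩ := ((hc y).isNilpotent_mul_left hz).isUnit_one_add
  refine ⟨(u⁻¹ : Λˣ), ?_⟩
  have h : ((u⁻¹ : Λˣ) : Λ) * (1 + y * z) = 1 := by rw [← hu, Units.inv_mul]
  rw [mul_add, mul_one, ← mul_assoc] at h
  rw [Ideal.mem_bot, add_comm (_ * _ * _), h, sub_self]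

/-- Let `a` be a central element acting nilpotently and suppose that every element of `s V` killed
by `a` lies in `a s V`. If the algebra is quasi-hereditary, then `s` annihilates the faithful
module `V`: every ideal of a heredity chain annihilates `s V`, because a heredity ideal `J` modulo
such an ideal satisfies `J a J s V = 0`, hence `a J s V = 0`, `J s V ⊆ a s V` and
`J J s V ⊆ a J s V = 0`. -/
theorem algebraMap_eq_zero_of_isQuasiHereditary {A : Type v} {Λ : Type u} {V : Type w} [CommRing A]
    [Ring Λ] [Algebra A Λ] [AddCommGroup V] [Module A V] [Module Λ V] [IsScalarTower A Λ V]
    [FaithfulSMul Λ V] {a s : A} (ha : IsNilpotent (algebraMap A Λ a))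
    (h : ∀ x : V, (a * s) • x = 0 → ∃ w : V, s • x = (a * s) • w) (hQ : IsQuasiHereditary Λ) :
    algebraMap A Λ s = 0 := by
  obtain ⟨m, J, hts, hmono, h0, hm, hJ⟩ := hQ
  have key : ∀ i ≤ m, ∀ φ ∈ J i, s • φ = 0 := by
    intro i
    induction i with
    | zero => intro _ φ hφ; rw [h0, Ideal.mem_bot] at hφ; simp [hφ]
    | succ i ih =>
      intro hi
      have ih := ih (by omega)
      have hH := hJ i (by omega)
      have hsurj : Function.Surjective (Ideal.Quotient.mk (J i)) := Ideal.Quotient.mk_surjective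
      have hrad : Ideal.Quotient.mk (J i) (algebraMap A Λ a) ∈ Ring.jacobson (Λ ⧸ J i) := by
        refine mem_ringJacobson_of_isNilpotent_of_commute (ha.map _) fun x ↦ ?_
        obtain ⟨x, rfl⟩ := hsurj x
        exact Commute.map (show Commute x (algebraMap A Λ a) from (Algebra.commutes a x).symm) _
      have hL : ∀ b : A, (∀ φ ∈ J (i + 1), ∀ ψ ∈ J (i + 1), b • (φ * ψ) = 0) →
          (∀ φ ∈ J i, b • φ = 0) → ∀ φ ∈ J (i + 1), b • φ = 0 := by
        intro b hb hbi φ hφ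
        let L : Ideal Λ := LinearMap.ker (LinearMap.toSpanSingleton Λ Λ (algebraMap A Λ b))
        have hLmem : ∀ x, x ∈ L ↔ b • x = 0 := fun x ↦ by
          rw [LinearMap.mem_ker, LinearMap.toSpanSingleton_apply, Algebra.smul_def, smul_eq_mul,
            Algebra.commutes]
        have h1 : Ideal.Quotient.mk (J i) φ ∈ (J (i + 1)).map (Ideal.Quotient.mk (J i)) :=
          Ideal.mem_map_of_mem _ hφ
        rw [← hH.idempotent] at h1
        have h2 : (J (i + 1)).map (Ideal.Quotient.mk (J i)) *
            (J (i + 1)).map (Ideal.Quotient.mk (J i)) ≤ L.map (Ideal.Quotient.mk (J i)) := by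
          rw [Ideal.mul_le]
          intro x hx y hy
          obtain ⟨x, hx', rfl⟩ := (Ideal.mem_map_iff_of_surjective _ hsurj).1 hx
          obtain ⟨y, hy', rfl⟩ := (Ideal.mem_map_iff_of_surjective _ hsurj).1 hy
          rw [← map_mul]
          exact Ideal.mem_map_of_mem _ ((hLmem _).2 (hb x hx' y hy'))
        obtain ⟨x, hx, hxφ⟩ := (Ideal.mem_map_iff_of_surjective _ hsurj).1 (h2 h1)
        have h3 : φ - x ∈ J i := Ideal.Quotient.eq.1 hxφ.symm
        have h4 := hbi _ h3
        rwa [smul_sub, (hLmem x).1 hx, sub_zero] at h4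
      have hstep : ∀ φ ∈ J (i + 1), (a * s) • φ = 0 := by
        refine hL (a * s) (fun φ hφ ψ hψ ↦ ?_) fun φ hφ ↦ by rw [mul_smul, ih φ hφ, smul_zero]
        have h1 : Ideal.Quotient.mk (J i) (φ * algebraMap A Λ a * ψ) = 0 := by
          rw [map_mul, map_mul, ← Ideal.mem_bot, ← hH.mul_rad_mul]
          exact Ideal.mul_mem_mul (Ideal.mul_mem_mul (Ideal.mem_map_of_mem _ hφ) hrad)
            (Ideal.mem_map_of_mem _ hψ)
        have h2 := ih _ (Ideal.Quotient.eq_zero_iff_mem.1 h1)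
        rwa [← Algebra.commutes, mul_assoc, ← Algebra.smul_def, smul_smul, mul_comm] at h2
      refine hL s (fun φ hφ ψ hψ ↦ ?_) ih
      refine FaithfulSMul.eq_of_smul_eq_smul (α := V) fun v ↦ ?_
      obtain ⟨w, hw⟩ := h (ψ • v) (by rw [← smul_assoc, hstep ψ hψ, zero_smul])
      have hcomm : ∀ (b : A) (x : V), b • φ • x = φ • b • x := fun b x ↦ by
        rw [← smul_assoc, ← algebraMap_smul Λ b x, Algebra.smul_def, Algebra.commutes, mul_smul]
      rw [smul_assoc, mul_smul, hcomm, hw, ← hcomm, ← smul_assoc, hstep φ hφ, zero_smul, zero_smul]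
  rw [Algebra.algebraMap_eq_smul_one]
  exact key m le_rfl 1 (hm ▸ Submodule.mem_top)

/-! ### Heredity ideals -/

theorem isHeredityIdeal_iff {Λ : Type u} [Ring Λ] {J : Ideal Λ} : IsHeredityIdeal J ↔
    J.IsTwoSided ∧ J ≤ J * J ∧ (∀ x ∈ J, ∀ r ∈ Ring.jacobson Λ, ∀ y ∈ J, x * r * y = 0) ∧
      Module.Projective Λ J := by
  constructor
  · intro h
    refine ⟨h.twoSided, h.idempotent.ge, fun x hx r hr y hy ↦ ?_, h.projective⟩
    rw [← Ideal.mem_bot, ← h.mul_rad_mul]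
    exact Ideal.mul_mem_mul (Ideal.mul_mem_mul hx hr) hy
  · rintro ⟨h1, h2, h3, h4⟩
    refine ⟨h1, le_antisymm Ideal.mul_le_left h2, ?_, h4⟩
    rw [eq_bot_iff, Ideal.mul_le]
    intro x hx y hy
    have h5 : J * Ring.jacobson Λ ≤ LinearMap.ker (LinearMap.toSpanSingleton Λ Λ y) :=
      Ideal.mul_le.2 fun x hx r hr ↦ h3 x hx r hr y hy
    exact h5 hx

theorem IsHeredityIdeal.comap_equiv {Λ : Type u} {Γ : Type v} [Ring Λ] [Ring Γ] {J : Ideal Γ}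
    (hJ : IsHeredityIdeal J) (e : Λ ≃+* Γ) : IsHeredityIdeal (J.comap e.toRingHom) := by
  obtain ⟨h1, h2, h3, h4⟩ := isHeredityIdeal_iff.1 hJ
  have hmem : ∀ x, x ∈ J.comap e.toRingHom ↔ e x ∈ J := fun x ↦ Iff.rfl
  refine isHeredityIdeal_iff.2 ⟨⟨fun {a} b ha ↦ ?_⟩, fun x hx ↦ ?_, fun x hx r hr y hy ↦ ?_, ?_⟩
  · rw [hmem, map_mul]
    exact h1.mul_mem_of_left (e b) ((hmem a).1 ha)
  · have h5 : J * J ≤ (J.comap e.toRingHom * J.comap e.toRingHom).comap e.symm.toRingHom := by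
      rw [Ideal.mul_le]
      intro a ha b hb
      change e.symm (a * b) ∈ J.comap e.toRingHom * J.comap e.toRingHom
      rw [map_mul]
      exact Ideal.mul_mem_mul ((hmem _).2 (by simpa using ha)) ((hmem _).2 (by simpa using hb))
    have h6 : e.symm (e x) ∈ J.comap e.toRingHom * J.comap e.toRingHom := h5 (h2 hx)
    simpa using h6
  · apply e.injective
    rw [map_mul, map_mul, map_zero]
    refine h3 _ hx _ ?_ _ hy
    have : RingHomSurjective e.toRingHom := ⟨e.surjective⟩
    exact Ring.le_comap_jacobson e.toRingHom hr
  · have hi1 : RingHomInvPair e.toRingHom e.symm.toRingHom := RingHomInvPair.of_ringEquiv e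
    have hi2 : RingHomInvPair e.symm.toRingHom e.toRingHom := RingHomInvPair.of_ringEquiv e.symm
    let g : J ≃ₛₗ[e.symm.toRingHom] J.comap e.toRingHom :=
      { toFun := fun x ↦ ⟨e.symm x.1, by rw [hmem]; simp⟩
        invFun := fun x ↦ ⟨e x.1, x.2⟩
        left_inv := fun x ↦ Subtype.ext (e.apply_symm_apply x.1)
        right_inv := fun x ↦ Subtype.ext (e.symm_apply_apply x.1)
        map_add' := fun x y ↦ Subtype.ext (map_add e.symm x.1 y.1)
        map_smul' := fun r x ↦ Subtype.ext (map_mul e.symm r x.1) }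
    exact Module.Projective.of_equiv g

/-- Heredity of `J / I` in `Λ / I` may be checked in the image of a ring homomorphism with
kernel `I`. -/
theorem IsHeredityIdeal.map_mk {Λ : Type u} {Γ : Type v} [Ring Λ] [Ring Γ] {f : Λ →+* Γ}
    (hf : Function.Surjective f) (I J : Ideal Λ) [I.IsTwoSided] (hI : I = RingHom.ker f)
    (hJ : IsHeredityIdeal (J.map f)) : IsHeredityIdeal (J.map (Ideal.Quotient.mk I)) := by
  subst hI
  let e := RingHom.quotientKerEquivOfSurjective hf
  have h := hJ.comap_equiv e
  have he : ∀ x, e (Ideal.Quotient.mk _ x) = f x := fun x ↦ rfl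
  convert h using 1
  ext x
  obtain ⟨x, rfl⟩ := Ideal.Quotient.mk_surjective x
  change _ ↔ f x ∈ J.map f
  rw [Ideal.mem_map_iff_of_surjective _ Ideal.Quotient.mk_surjective,
    Ideal.mem_map_iff_of_surjective _ hf]
  refine exists_congr fun y ↦ and_congr_right fun _ ↦ ?_
  rw [← e.injective.eq_iff, he, he]

/-! ### The heredity ideal of endomorphisms killed by a prime -/

section Torsion

variable {A : Type u} {W : Type v} [CommRing A] [AddCommGroup W] [Module A W]

/-- The map `A / q → W` sending `1` to an element `x` killed by `q`. -/
def liftTorsion {q : A} (x : W) (hx : q • x = 0) : (A ⧸ Ideal.span {q}) →ₗ[A] W :=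
  Submodule.liftQ _ (LinearMap.toSpanSingleton A W x) (by
    rw [Ideal.span, Submodule.span_le, Set.singleton_subset_iff]
    exact hx)

@[simp]
theorem liftTorsion_mk {q : A} (x : W) (hx : q • x = 0) (a : A) :
    liftTorsion x hx (Ideal.Quotient.mk _ a) = a • x := rfl

theorem smul_quotient_span_singleton_eq_zero (q : A) (x : A ⧸ Ideal.span {q}) : q • x = 0 := by
  obtain ⟨a, rfl⟩ := Ideal.Quotient.mk_surjective x
  exact Ideal.Quotient.eq_zero_iff_mem.2
    (Ideal.mul_mem_right _ _ (Ideal.mem_span_singleton_self q))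

open Pointwise in
/-- Lifts to `W` of a basis of the vector space `W / q W`, with the coordinate functions. -/
theorem exists_dual_basis_mod [Module.Finite A W] {q : A} (hq : (Ideal.span {q}).IsMaximal) :
    ∃ (N : ℕ) (x : Fin N → W) (η : Fin N → W →ₗ[A] A ⧸ Ideal.span {q}),
      ∀ w, ∃ (c : Fin N → A) (u : W), (∀ j, Ideal.Quotient.mk _ (c j) = η j w) ∧
        w = ∑ j, c j • x j + q • u := by
  let I := Ideal.span {q}
  let _ : Field (A ⧸ I) := Ideal.Quotient.field I
  have hfin : Module.Finite (A ⧸ I) (W ⧸ (I • ⊤ : Submodule A W)) :=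
    Module.Finite.of_restrictScalars_finite A _ _
  let b := Module.finBasis (A ⧸ I) (W ⧸ (I • ⊤ : Submodule A W))
  choose x hx using fun j ↦ Submodule.mkQ_surjective (I • ⊤ : Submodule A W) (b j)
  refine ⟨_, x, fun j ↦ ((b.coord j).restrictScalars A) ∘ₗ Submodule.mkQ _, fun w ↦ ?_⟩
  choose c hc using fun j ↦ Ideal.Quotient.mk_surjective
    (b.coord j ((I • ⊤ : Submodule A W).mkQ w))
  have h : (I • ⊤ : Submodule A W).mkQ (w - ∑ j, c j • x j) = 0 := by
    rw [map_sub, map_sum, sub_eq_zero]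
    conv_lhs => rw [← b.sum_repr ((I • ⊤ : Submodule A W).mkQ w)]
    refine Finset.sum_congr rfl fun j _ ↦ ?_
    rw [map_smul, hx, ← b.coord_apply, ← hc j]
    rfl
  have h' : w - ∑ j, c j • x j ∈ (q • ⊤ : Submodule A W) := by
    rw [← Submodule.ideal_span_singleton_smul]
    exact (Submodule.Quotient.mk_eq_zero _).1 h
  obtain ⟨u, -, hu⟩ := h'
  exact ⟨c, u, hc, by rw [DistribSMul.toLinearMap_apply] at hu; rw [hu]; abel⟩

/-- Let `A / q` be a direct summand of `W`, where `q` generates a maximal ideal. Then the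
endomorphisms of `W` killed by `q` form a heredity ideal: they are the endomorphisms that factor
through a power of `A / q`. -/
theorem isHeredityIdeal_of_forall_mem_iff [Module.Finite A W] {q : A}
    (hq : (Ideal.span {q}).IsMaximal) {y : W} (hy : q • y = 0) {π : W →ₗ[A] A ⧸ Ideal.span {q}}
    (hπ : π y = 1) {J : Ideal (Module.End A W)} (hJ : ∀ ψ, ψ ∈ J ↔ q • ψ = 0) :
    IsHeredityIdeal J := by
  obtain ⟨N, x, η, hdual⟩ := exists_dual_basis_mod (W := W) hq
  let _ : Field (A ⧸ Ideal.span {q}) := Ideal.Quotient.field _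
  have hkill : ∀ ψ ∈ J, ∀ w, q • ψ w = 0 := fun ψ hψ w ↦ by
    rw [← LinearMap.smul_apply, (hJ ψ).1 hψ, LinearMap.zero_apply]
  have hfac : ∀ (z : W) (hz : q • z = 0) (χ : W →ₗ[A] A ⧸ Ideal.span {q}),
      liftTorsion z hz ∘ₗ χ ∈ J := fun z hz χ ↦ by
    refine (hJ _).2 (LinearMap.ext fun w ↦ ?_)
    rw [LinearMap.smul_apply, LinearMap.comp_apply, ← map_smul,
      smul_quotient_span_singleton_eq_zero, map_zero, LinearMap.zero_apply]
  have hdecomp : ∀ ψ (hψ : ψ ∈ J),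
      ψ = ∑ j, liftTorsion (ψ (x j)) (hkill ψ hψ _) ∘ₗ η j := fun ψ hψ ↦ by
    ext w
    obtain ⟨c, u, hc, hw⟩ := hdual w
    simp only [LinearMap.sum_apply, LinearMap.comp_apply, ← hc, liftTorsion_mk]
    conv_lhs => rw [hw]
    simp [hkill ψ hψ u]
  let e : Module.End A W := liftTorsion y hy ∘ₗ π
  have hpull : ∀ (z : W) (hz : q • z = 0) (χ : W →ₗ[A] A ⧸ Ideal.span {q}),
      liftTorsion z hz ∘ₗ χ = (liftTorsion z hz ∘ₗ π) * (liftTorsion y hy ∘ₗ χ) :=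
      fun z hz χ ↦ by
    ext w
    obtain ⟨a, ha⟩ := Ideal.Quotient.mk_surjective (χ w)
    simp only [LinearMap.comp_apply, Module.End.mul_apply, ← ha, liftTorsion_mk, map_smul, hπ]
    rw [← liftTorsion_mk z hz]
    rw [← mul_one (Ideal.Quotient.mk _ a)]
    exact (liftTorsion z hz).map_smul a 1
  refine isHeredityIdeal_iff.2 ⟨⟨fun {a} b ha ↦ ?_⟩, fun ψ hψ ↦ ?_, fun ψ hψ r hr φ hφ ↦ ?_, ?_⟩
  · rw [hJ] at ha ⊢
    rw [← smul_mul_assoc, ha, zero_mul]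
  · rw [hdecomp ψ hψ]
    refine Ideal.sum_mem _ fun j _ ↦ ?_
    rw [hpull]
    exact Ideal.mul_mem_mul (hfac _ _ _) (hfac _ _ _)
  · -- An endomorphism of `W` inducing a nonzero map `A / q → W → A / q` is not in the radical,
    -- since after multiplication with an inverse in `A / q` it yields an idempotent.
    have hmid : ∀ (z : W) (hz : q • z = 0) (χ : W →ₗ[A] A ⧸ Ideal.span {q}), χ (r z) = 0 := by
      intro z hz χ
      by_contra hne
      obtain ⟨a, ha⟩ := Ideal.Quotient.mk_surjective ((χ (r z))⁻¹)
      obtain ⟨b, hb⟩ := Ideal.Quotient.mk_surjective (χ (r z))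
      let f : Module.End A W := (a • (liftTorsion y hy ∘ₗ χ)) * r * (liftTorsion z hz ∘ₗ π)
      have hf : f ∈ Ring.jacobson (Module.End A W) :=
        Ideal.mul_mem_right _ _ (Ideal.mul_mem_left _ _ hr)
      have hab : (Ideal.Quotient.mk (Ideal.span {q}) (a * b)) = 1 := by
        rw [map_mul, ha, hb, inv_mul_cancel₀ hne]
      have hfe : f = e := by
        ext w
        obtain ⟨t, ht⟩ := Ideal.Quotient.mk_surjective (π w)
        simp only [f, e, Module.End.mul_apply, LinearMap.comp_apply, LinearMap.smul_apply, ← ht,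
          liftTorsion_mk, map_smul]
        rw [← hb, liftTorsion_mk, smul_smul a b, ← liftTorsion_mk y hy, hab,
          ← map_one (Ideal.Quotient.mk _), liftTorsion_mk, one_smul]
      have hey : e y = y := by
        simp only [e, LinearMap.comp_apply, hπ]
        rw [← map_one (Ideal.Quotient.mk _), liftTorsion_mk, one_smul]
      rw [hfe, ← Ideal.jacobson_bot, Ideal.mem_jacobson_iff] at hf
      obtain ⟨s, hs⟩ := hf (-1)
      rw [Ideal.mem_bot] at hs
      have h1 := LinearMap.congr_fun hs y
      simp only [LinearMap.sub_apply, LinearMap.add_apply, Module.End.mul_apply, hey,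
        Module.End.one_apply, LinearMap.neg_apply, map_neg, LinearMap.zero_apply] at h1
      have hy0 : y = 0 := by
        rw [neg_add_cancel, zero_sub, neg_eq_zero] at h1
        exact h1
      rw [hy0, map_zero] at hπ
      exact zero_ne_one hπ
    rw [hdecomp ψ hψ, Finset.sum_mul, Finset.sum_mul]
    refine Finset.sum_eq_zero fun j _ ↦ LinearMap.ext fun w ↦ ?_
    simp only [Module.End.mul_apply, LinearMap.comp_apply, LinearMap.zero_apply]
    rw [hmid _ (hkill φ hφ w), map_zero]
  · let i : J →ₗ[Module.End A W] (Fin N → Module.End A W) :=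
      { toFun := fun ψ j ↦ liftTorsion (ψ.1 (x j)) (hkill ψ.1 ψ.2 _) ∘ₗ π
        map_add' := fun ψ φ ↦ by
          ext j w
          obtain ⟨t, ht⟩ := Ideal.Quotient.mk_surjective (π w)
          simp [← ht]
        map_smul' := fun γ ψ ↦ by
          ext j w
          obtain ⟨t, ht⟩ := Ideal.Quotient.mk_surjective (π w)
          simp [← ht] }
    let s : (Fin N → Module.End A W) →ₗ[Module.End A W] J :=
      { toFun := fun γ ↦ ⟨∑ j, γ j * (liftTorsion y hy ∘ₗ η j),
          Ideal.sum_mem _ fun j _ ↦ Ideal.mul_mem_left _ _ (hfac _ _ _)⟩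
        map_add' := fun γ δ ↦ by
          ext1
          simp [add_mul, Finset.sum_add_distrib]
        map_smul' := fun γ δ ↦ by
          ext1
          simp [Finset.mul_sum, mul_assoc] }
    refine Module.Projective.of_split i s (LinearMap.ext fun ψ ↦ Subtype.ext ?_)
    change ∑ j, (liftTorsion (ψ.1 (x j)) _ ∘ₗ π) * (liftTorsion y hy ∘ₗ η j) = ψ.1
    conv_rhs => rw [hdecomp ψ.1 ψ.2]
    exact Finset.sum_congr rfl fun j _ ↦ (hpull _ _ _).symm

end Torsion

/-! ### Construction of a heredity chain -/

section Chain

variable {A : Type u} {Λ : Type v} {V : Type w} [CommRing A] [Ring Λ] [AddCommGroup V]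
  [Module A V] [Module Λ V] [SMulCommClass Λ A V]

variable (Λ V) in
/-- The action of `Λ` on the submodule `d V` of `V`. -/
def actionOnSmul (d : A) : Λ →+* Module.End A (LinearMap.range (LinearMap.lsmul A V d)) where
  toFun r := (Module.toModuleEnd A (S := Λ) V r).restrict (by
    rintro _ ⟨v, rfl⟩
    exact ⟨r • v, (smul_comm r d v).symm⟩)
  map_one' := by ext; simp
  map_mul' r s := by ext; simp [mul_smul]
  map_zero' := by ext; simp
  map_add' r s := by ext; simp [add_smul]

theorem actionOnSmul_apply (d : A) (r : Λ)
    (x : LinearMap.range (LinearMap.lsmul A V d)) : (actionOnSmul Λ V d r x : V) = r • x.1 := rfl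

theorem mem_ker_actionOnSmul {d : A} {r : Λ} :
    r ∈ RingHom.ker (actionOnSmul Λ V d) ↔ ∀ v : V, d • r • v = 0 := by
  rw [RingHom.mem_ker]
  constructor
  · intro h v
    have h1 := congrArg Subtype.val (LinearMap.congr_fun h ⟨d • v, v, rfl⟩)
    rw [actionOnSmul_apply] at h1
    rw [← smul_comm]
    exact h1
  · intro h
    ext ⟨_, v, rfl⟩
    exact (smul_comm r d v).trans (h v)

/-- A heredity chain is obtained from a sequence of primes `q₁, q₂, …`: its ideals consist of the
elements killed by `q₁ ⋯ qᵢ`. -/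
theorem isQuasiHereditary_of_list [Module.Finite A V]
    (hsurj : ∀ d : A, Function.Surjective (actionOnSmul Λ V d))
    [FaithfulSMul Λ V] (l : List A) (hl : ∀ v : V, l.prod • v = 0)
    (hmax : ∀ q ∈ l, (Ideal.span {q}).IsMaximal)
    (hsum : ∀ (i : ℕ) (hi : i < l.length),
      ∃ (y : LinearMap.range (LinearMap.lsmul A V (l.take i).prod))
        (π : LinearMap.range (LinearMap.lsmul A V (l.take i).prod) →ₗ[A] A ⧸ Ideal.span {l[i]}),
        l[i] • y = 0 ∧ π y = 1) :
    IsQuasiHereditary Λ := by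
  refine ⟨l.length, fun i ↦ RingHom.ker (actionOnSmul Λ V (l.take i).prod),
    fun i ↦ inferInstance, ?_, ?_, ?_, fun i hi ↦ ?_⟩
  · refine monotone_nat_of_le_succ fun i r hr ↦ ?_
    rw [mem_ker_actionOnSmul] at hr ⊢
    intro v
    by_cases hi : i < l.length
    · rw [List.prod_take_succ l i hi, mul_comm, mul_smul, hr v, smul_zero]
    · rw [List.take_of_length_le (by omega)] at hr ⊢
      exact hr v
  · rw [eq_bot_iff]
    intro r hr
    rw [mem_ker_actionOnSmul] at hr
    refine (Ideal.mem_bot).2 (FaithfulSMul.eq_of_smul_eq_smul (α := V) fun v ↦ ?_)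
    simpa using hr v
  · rw [eq_top_iff]
    intro r _
    rw [mem_ker_actionOnSmul]
    intro v
    rw [List.take_length, hl]
  · obtain ⟨y, π, hy, hπ⟩ := hsum i hi
    refine IsHeredityIdeal.map_mk (hsurj (l.take i).prod) _ _ rfl
      (isHeredityIdeal_of_forall_mem_iff (hmax _ (List.getElem_mem hi)) hy hπ fun ψ ↦ ?_)
    rw [Ideal.mem_map_iff_of_surjective _ (hsurj _)]
    constructor
    · rintro ⟨r, hr, rfl⟩
      rw [mem_ker_actionOnSmul, List.prod_take_succ l i hi] at hr
      ext ⟨_, v, rfl⟩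
      have := hr v
      rw [mul_comm, mul_smul, ← smul_comm r _ v] at this
      exact this
    · intro hψ
      obtain ⟨r, rfl⟩ := hsurj _ ψ
      refine ⟨r, mem_ker_actionOnSmul.2 fun v ↦ ?_, rfl⟩
      have h1 := congrArg Subtype.val (LinearMap.congr_fun hψ ⟨(l.take i).prod • v, v, rfl⟩)
      rw [List.prod_take_succ l i hi, mul_comm, mul_smul, ← smul_comm r _ v]
      exact h1

end Chain

/-! ### Sums of cyclic modules over a principal ideal domain -/

section Cyclic

variable {A : Type u} [CommRing A] [IsDomain A] [IsPrincipalIdealRing A]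

/-- A common multiple of finitely many elements without superfluous prime powers. -/
theorem exists_lcm {ι : Type*} [Finite ι] (h : ι → A) (hne : ∀ j, h j ≠ 0) :
    ∃ χ : A, χ ≠ 0 ∧ (∀ j, h j ∣ χ) ∧
      ∀ q, Prime q → ∀ k, 1 ≤ k → q ^ k ∣ χ → ∃ j, q ^ k ∣ h j := by
  classical
  cases nonempty_fintype ι
  suffices H : ∀ s : Finset ι, ∃ χ : A, χ ≠ 0 ∧ (∀ j ∈ s, h j ∣ χ) ∧
      ∀ q, Prime q → ∀ k, 1 ≤ k → q ^ k ∣ χ → ∃ j, q ^ k ∣ h j by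
    obtain ⟨χ, h0, h1, h2⟩ := H Finset.univ
    exact ⟨χ, h0, fun j ↦ h1 j (Finset.mem_univ j), h2⟩
  intro s
  induction s using Finset.induction_on with
  | empty =>
    refine ⟨1, one_ne_zero, by simp, fun q hq k hk hd ↦ ?_⟩
    exact absurd (isUnit_of_dvd_one ((dvd_pow_self q (by omega)).trans hd)) hq.not_isUnit
  | insert i s _ ih =>
    obtain ⟨χ, h0, h1, h2⟩ := ih
    obtain ⟨a, b, c, hrel, rfl, hb⟩ :=
      UniqueFactorizationMonoid.exists_reduced_factors χ h0 (h i)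
    have hb0 : b ≠ 0 := by
      rintro rfl
      exact hne i (by rw [← hb, mul_zero])
    refine ⟨c * a * b, mul_ne_zero h0 hb0, fun j hj ↦ ?_, fun q hq k hk hd ↦ ?_⟩
    · rcases Finset.mem_insert.1 hj with rfl | hj
      · rw [← hb, mul_right_comm]
        exact dvd_mul_right _ _
      · exact (h1 j hj).mul_right _
    · by_cases hqb : q ∣ b
      · have hqa : ¬ q ∣ a := fun hqa ↦ hq.not_isUnit (hrel hqa hqb)
        refine ⟨i, ?_⟩
        rw [← hb]
        rw [mul_right_comm] at hd
        exact hq.pow_dvd_of_dvd_mul_right k hqa hd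
      · exact h2 q hq k hk (hq.pow_dvd_of_dvd_mul_right k hqb hd)

variable {ι : Type w} [Fintype ι] [DecidableEq ι] {h : ι → A}

/-- The element `1` of the summand `A / h j`. -/
def cyclicGen (h : ι → A) (j : ι) : (j : ι) → A ⧸ Ideal.span {h j} := Pi.single j 1

omit [IsDomain A] [IsPrincipalIdealRing A] [Fintype ι] in
@[simp]
theorem cyclicGen_self (j : ι) : cyclicGen h j j = 1 := Pi.single_eq_same _ _

omit [IsDomain A] [IsPrincipalIdealRing A] [Fintype ι] in
theorem smul_cyclicGen_self (j : ι) : h j • cyclicGen h j = 0 := by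
  rw [cyclicGen, ← Pi.single_smul, smul_quotient_span_singleton_eq_zero, Pi.single_zero]

omit [IsDomain A] [IsPrincipalIdealRing A] in
theorem exists_eq_sum_smul_cyclicGen (v : (j : ι) → A ⧸ Ideal.span {h j}) :
    ∃ c : ι → A, (∀ j, Ideal.Quotient.mk _ (c j) = v j) ∧ v = ∑ j, c j • cyclicGen h j := by
  choose c hc using fun j ↦ Ideal.Quotient.mk_surjective (v j)
  refine ⟨c, hc, ?_⟩
  conv_lhs => rw [← Finset.univ_sum_single v]
  refine Finset.sum_congr rfl fun j _ ↦ ?_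
  rw [cyclicGen, ← Pi.single_smul, ← hc j]
  congr 1
  rw [← mul_one (Ideal.Quotient.mk _ (c j))]
  rfl

/-- Every endomorphism of `d V` extends to an endomorphism of the sum of cyclic modules `V`. -/
theorem surjective_actionOnSmul {Λ : Type v} [Ring Λ]
    [Module Λ ((j : ι) → A ⧸ Ideal.span {h j})] [SMulCommClass Λ A ((j : ι) → A ⧸ Ideal.span {h j})]
    (hΛ : ∀ φ : Module.End A ((j : ι) → A ⧸ Ideal.span {h j}), ∃ r : Λ, ∀ v, r • v = φ v) (d : A) :
    Function.Surjective (actionOnSmul Λ ((j : ι) → A ⧸ Ideal.span {h j}) d) := by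
  intro ψ
  -- By Bézout, the image of `d · 1` is `d w` for some `w` with the same annihilator as `1`.
  have hex : ∀ j, ∃ w : (j : ι) → A ⧸ Ideal.span {h j}, h j • w = 0 ∧
      d • w = (ψ ⟨d • cyclicGen h j, cyclicGen h j, rfl⟩).1 := by
    intro j
    by_cases hd : d = 0
    · refine ⟨0, smul_zero _, ?_⟩
      have : (⟨d • cyclicGen h j, cyclicGen h j, rfl⟩ :
          LinearMap.range (LinearMap.lsmul A ((j : ι) → A ⧸ Ideal.span {h j}) d)) = 0 := by
        ext1
        simp [hd]
      rw [this, map_zero, smul_zero]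
      rfl
    obtain ⟨g, hg⟩ := (IsPrincipalIdealRing.principal (Ideal.span {h j, d})).principal
    have hgm : g ∈ Ideal.span {h j, d} := by rw [hg]; exact Submodule.mem_span_singleton_self g
    have hh : h j ∈ Ideal.span {g} := by
      rw [Ideal.span, ← hg]; exact Ideal.subset_span (by simp)
    have hdd : d ∈ Ideal.span {g} := by
      rw [Ideal.span, ← hg]; exact Ideal.subset_span (by simp)
    obtain ⟨h', hh'⟩ := Ideal.mem_span_singleton.1 hh
    obtain ⟨d', hd'⟩ := Ideal.mem_span_singleton.1 hdd
    obtain ⟨α, β, hαβ⟩ := Ideal.mem_span_pair.1 hgm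
    obtain ⟨w, hw⟩ := (ψ ⟨d • cyclicGen h j, cyclicGen h j, rfl⟩).2
    have hw : d • w = (ψ ⟨d • cyclicGen h j, cyclicGen h j, rfl⟩).1 := hw
    have hkill : h' • d • w = 0 := by
      have h1 : h' • (⟨d • cyclicGen h j, cyclicGen h j, rfl⟩ :
          LinearMap.range (LinearMap.lsmul A ((j : ι) → A ⧸ Ideal.span {h j}) d)) = 0 := by
        ext1
        change h' • d • cyclicGen h j = 0
        rw [smul_smul, show h' * d = d' * h j by rw [hd', hh']; ring, mul_smul,
          smul_cyclicGen_self, smul_zero]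
      rw [hw, ← Submodule.coe_smul, ← map_smul, h1, map_zero, Submodule.coe_zero]
    have hg0 : g ≠ 0 := by
      rintro rfl
      exact hd (by rw [hd', zero_mul])
    have hbez : β * d' = 1 - α * h' := by
      apply mul_left_cancel₀ hg0
      linear_combination (-1 : A) * β * hd' - α * hh' + hαβ
    refine ⟨(β * d') • w, ?_, ?_⟩
    · rw [smul_smul, show h j * (β * d') = β * (h' * d) by rw [hh', hd']; ring, mul_smul, mul_smul,
        hkill, smul_zero]
    · rw [hbez, smul_smul, mul_comm, mul_smul, sub_smul, one_smul, mul_smul, hkill, smul_zero,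
        sub_zero, hw]
  choose w hw hdw using hex
  let φ : Module.End A ((j : ι) → A ⧸ Ideal.span {h j}) :=
    ∑ j, liftTorsion (w j) (hw j) ∘ₗ LinearMap.proj j
  obtain ⟨r, hr⟩ := hΛ φ
  refine ⟨r, LinearMap.ext ?_⟩
  rintro ⟨_, v, rfl⟩
  obtain ⟨c, hc, hv⟩ := exists_eq_sum_smul_cyclicGen v
  apply Subtype.ext
  rw [actionOnSmul_apply]
  change r • d • v = _
  have h1 : (⟨LinearMap.lsmul A _ d v, v, rfl⟩ :
      LinearMap.range (LinearMap.lsmul A ((j : ι) → A ⧸ Ideal.span {h j}) d)) =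
      ∑ j, c j • ⟨d • cyclicGen h j, cyclicGen h j, rfl⟩ := by
    ext1
    rw [AddSubmonoidClass.coe_finsetSum]
    change d • v = ∑ j, c j • d • cyclicGen h j
    conv_lhs => rw [hv]
    rw [Finset.smul_sum]
    exact Finset.sum_congr rfl fun j _ ↦ smul_comm _ _ _
  rw [h1, map_sum, AddSubmonoidClass.coe_finsetSum, hr, map_smul]
  simp only [φ, LinearMap.sum_apply, LinearMap.comp_apply, LinearMap.proj_apply, ← hc,
    liftTorsion_mk, Finset.smul_sum, map_smul, Submodule.coe_smul, ← hdw]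
  exact Finset.sum_congr rfl fun j _ ↦ smul_comm _ _ _

omit [Fintype ι] [IsPrincipalIdealRing A] in
/-- If `q ^ k` is the power of `q` in `d`, then a summand `A / q ^ (k + 1)` of `V` yields a
summand `A / q` of `d V`. -/
theorem exists_summand_smul {q d d' : A} (hq : Prime q) {k : ℕ} (hd : d = q ^ k * d')
    (hd' : ¬ q ∣ d') {j : ι} (hj : Associated (h j) (q ^ (k + 1))) :
    ∃ (y : LinearMap.range (LinearMap.lsmul A ((j : ι) → A ⧸ Ideal.span {h j}) d))
      (π : LinearMap.range (LinearMap.lsmul A ((j : ι) → A ⧸ Ideal.span {h j}) d) →ₗ[A]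
        A ⧸ Ideal.span {q}), q • y = 0 ∧ π y = 1 := by
  have hqd : ∀ a : A, h j ∣ a * d ↔ q ∣ a := by
    intro a
    rw [hj.dvd_iff_dvd_left, hd, show a * (q ^ k * d') = q ^ k * (a * d') by ring, pow_succ,
      mul_dvd_mul_iff_left (pow_ne_zero k hq.ne_zero), hq.dvd_mul, or_iff_left hd']
  have hy : q • d • cyclicGen h j = 0 := by
    obtain ⟨b, hb⟩ := (hqd q).2 dvd_rfl
    rw [smul_smul, hb, mul_comm, mul_smul, smul_cyclicGen_self, smul_zero]
  let μ : (A ⧸ Ideal.span {q}) →ₗ[A] A ⧸ Ideal.span {h j} :=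
    LinearMap.proj j ∘ₗ liftTorsion (d • cyclicGen h j) hy
  have hμ : ∀ a, μ (Ideal.Quotient.mk _ a) = Ideal.Quotient.mk _ (a * d) := by
    intro a
    have h1 : μ (Ideal.Quotient.mk _ a) = a • d • (1 : A ⧸ Ideal.span {h j}) := by
      simp [μ, cyclicGen]
    rw [h1, smul_smul, ← mul_one (Ideal.Quotient.mk _ (a * d))]
    rfl
  have hinj : Function.Injective μ := by
    rw [injective_iff_map_eq_zero]
    intro x hx
    obtain ⟨a, rfl⟩ := Ideal.Quotient.mk_surjective x
    rw [hμ, Ideal.Quotient.eq_zero_iff_dvd, hqd] at hx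
    exact (Ideal.Quotient.eq_zero_iff_dvd _ _).2 hx
  let e := LinearEquiv.ofInjective μ hinj
  let f : LinearMap.range (LinearMap.lsmul A ((j : ι) → A ⧸ Ideal.span {h j}) d) →ₗ[A]
      LinearMap.range μ := LinearMap.restrict (LinearMap.proj j) (by
    rintro _ ⟨v, rfl⟩
    obtain ⟨a, ha⟩ := Ideal.Quotient.mk_surjective (v j)
    refine ⟨Ideal.Quotient.mk _ a, ?_⟩
    rw [hμ, mul_comm]
    change _ = d • v j
    rw [← ha]
    rfl)
  refine ⟨⟨d • cyclicGen h j, cyclicGen h j, rfl⟩, e.symm.toLinearMap ∘ₗ f, Subtype.ext hy, ?_⟩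
  rw [LinearMap.comp_apply, LinearEquiv.coe_coe, LinearEquiv.symm_apply_eq]
  apply Subtype.ext
  change d • cyclicGen h j j = μ 1
  rw [← map_one (Ideal.Quotient.mk _), hμ, one_mul, ← mul_one (Ideal.Quotient.mk _ d)]
  simp only [cyclicGen, Pi.single_eq_same]
  rfl

/-- Suppose that every prime power dividing some `h i` is, up to units, one of the `h j`. Then the
endomorphism algebra of the sum of the `A / h j` is quasi-hereditary. -/
theorem isQuasiHereditary_of_forall_associated {Λ : Type v} [Ring Λ]
    [Module Λ ((j : ι) → A ⧸ Ideal.span {h j})] [SMulCommClass Λ A ((j : ι) → A ⧸ Ideal.span {h j})]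
    [FaithfulSMul Λ ((j : ι) → A ⧸ Ideal.span {h j})]
    (hΛ : ∀ φ : Module.End A ((j : ι) → A ⧸ Ideal.span {h j}), ∃ r : Λ, ∀ v, r • v = φ v)
    (hne : ∀ j, h j ≠ 0)
    (hH : ∀ q, Prime q → ∀ k, 1 ≤ k → ∀ i, q ^ k ∣ h i → ∃ j, Associated (h j) (q ^ k)) :
    IsQuasiHereditary Λ := by
  obtain ⟨χ, hχ0, hχ1, hχ2⟩ := exists_lcm h hne
  obtain ⟨f, hf, hfχ⟩ := UniqueFactorizationMonoid.exists_prime_factors χ hχ0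
  have hfl : ∀ q ∈ f.toList, Prime q := fun q hq ↦ hf q (Multiset.mem_toList.1 hq)
  rw [← Multiset.prod_toList] at hfχ
  refine isQuasiHereditary_of_list (A := A) (V := (j : ι) → A ⧸ Ideal.span {h j})
    (surjective_actionOnSmul hΛ) f.toList (fun v ↦ ?_)
    (fun q hq ↦ PrincipalIdealRing.isMaximal_of_irreducible (hfl q hq).irreducible)
    fun i hi ↦ ?_
  · funext j
    obtain ⟨b, hb⟩ := (hχ1 j).trans hfχ.symm.dvd
    rw [hb, mul_comm, mul_smul, Pi.smul_apply, Pi.smul_apply,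
      smul_quotient_span_singleton_eq_zero, smul_zero]
    rfl
  · have hq := hfl _ (List.getElem_mem hi)
    have hd0 : (f.toList.take i).prod ≠ 0 := List.prod_ne_zero fun h0 ↦
      (hfl 0 (List.mem_of_mem_take h0)).ne_zero rfl
    obtain ⟨d', hd, hd'⟩ :=
      FiniteMultiplicity.exists_eq_pow_mul_and_not_dvd (FiniteMultiplicity.of_prime_left hq hd0)
    generalize multiplicity f.toList[i] (f.toList.take i).prod = k at hd
    have hdvd : f.toList[i] ^ (k + 1) ∣ χ := by
      refine Dvd.dvd.trans ?_ ((List.take_sublist (i + 1) f.toList).prod_dvd_prod.trans hfχ.dvd)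
      rw [List.prod_take_succ _ i hi, hd, pow_succ, mul_right_comm]
      exact dvd_mul_right _ _
    obtain ⟨i', hi'⟩ := hχ2 _ hq _ (by omega) hdvd
    obtain ⟨j, hj⟩ := hH _ hq _ (by omega) i' hi'
    exact exists_summand_smul hq hd hd' hj

end Cyclic

/-! ### Global dimension at most two -/

theorem hasProjectiveDimensionLT_iff_ker {Λ : Type v} [Ring Λ] {F X : Type v} [AddCommGroup F]
    [Module Λ F] [AddCommGroup X] [Module Λ X] [Module.Projective Λ F] {f : F →ₗ[Λ] X}
    (hf : Function.Surjective f) (n : ℕ) :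
    CategoryTheory.HasProjectiveDimensionLT (ModuleCat.of Λ X) (n + 2) ↔
      CategoryTheory.HasProjectiveDimensionLT (ModuleCat.of Λ (LinearMap.ker f)) (n + 1) :=
  (LinearMap.shortExact_shortComplexKer hf).hasProjectiveDimensionLT_X₃_iff n
    ((IsProjective.iff_projective F).1 inferInstance)

theorem hasProjectiveDimensionLT_one_iff {Λ : Type v} [Ring Λ] {X : Type v} [AddCommGroup X]
    [Module Λ X] : CategoryTheory.HasProjectiveDimensionLT (ModuleCat.of Λ X) 1 ↔
      Module.Projective Λ X := by
  rw [← CategoryTheory.projective_iff_hasProjectiveDimensionLT_one,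
    ← IsProjective.iff_projective]

section Kernel

variable {A : Type u} {Λ : Type v} {V : Type w} [CommRing A] [Ring Λ] [AddCommGroup V]
  [Module A V] [Module Λ V] [SMulCommClass A Λ V]

/-- If `D` is a direct summand of a power of `V`, then `Hom (D, V)` is a projective module over the
endomorphism algebra of `V`. -/
theorem projective_linearMap [FaithfulSMul Λ V]
    (hΛ : ∀ φ : Module.End A V, ∃ r : Λ, ∀ v, r • v = φ v) {D : Type*} [AddCommGroup D] [Module A D]
    {κ : Type*} [Fintype κ] (i : D →ₗ[A] κ → V) (p : (κ → V) →ₗ[A] D)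
    (hpi : p ∘ₗ i = LinearMap.id) : Module.Projective Λ (D →ₗ[A] V) := by
  classical
  have hcomm : SMulCommClass Λ A V := SMulCommClass.symm _ _ _
  let ρ : Λ →ₗ[Λ] (V →ₗ[A] V) :=
    { toFun := fun r ↦ Module.toModuleEnd A (S := Λ) V r
      map_add' := fun r s ↦ map_add _ r s
      map_smul' := fun r s ↦ LinearMap.ext fun v ↦ mul_smul r s v }
  have hρ : Function.Bijective ρ := by
    constructor
    · intro r s hrs
      exact FaithfulSMul.eq_of_smul_eq_smul (α := V) fun v ↦ LinearMap.congr_fun hrs v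
    · intro φ
      obtain ⟨r, hr⟩ := hΛ φ
      exact ⟨r, LinearMap.ext hr⟩
  have hfree : Module.Free Λ (V →ₗ[A] V) := Module.Free.of_equiv (LinearEquiv.ofBijective ρ hρ)
  let I : (D →ₗ[A] V) →ₗ[Λ] (κ → V →ₗ[A] V) :=
    { toFun := fun f k ↦ f ∘ₗ p ∘ₗ LinearMap.single A (fun _ ↦ V) k
      map_add' := fun f g ↦ rfl
      map_smul' := fun r f ↦ rfl }
  let s : (κ → V →ₗ[A] V) →ₗ[Λ] (D →ₗ[A] V) :=
    { toFun := fun χ ↦ ∑ k, χ k ∘ₗ LinearMap.proj k ∘ₗ i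
      map_add' := fun f g ↦ by
        ext d
        simp [Finset.sum_add_distrib]
      map_smul' := fun r f ↦ by
        ext d
        simp [Finset.smul_sum] }
  refine Module.Projective.of_split I s (LinearMap.ext fun f ↦ LinearMap.ext fun d ↦ ?_)
  have h1 : d = p (∑ k, Pi.single k (i d k)) := by
    rw [Finset.univ_sum_single]
    exact (LinearMap.congr_fun hpi d).symm
  conv_rhs => rw [h1]
  simp [s, I]

/-- The kernel of a map between free modules over the endomorphism algebra of `V` has the form
`Hom (D, V)`, where `D` is the cokernel of the corresponding map between powers of `V`. -/
theorem projective_ker_of_forall_summand [FaithfulSMul Λ V] [Module.Finite A V]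
    (hΛ : ∀ φ : Module.End A V, ∃ r : Λ, ∀ v, r • v = φ v)
    (hsummand : ∀ (D : Type w) [AddCommGroup D] [Module A D] [Module.Finite A D],
      (∀ a : A, (∀ v : V, a • v = 0) → ∀ x : D, a • x = 0) →
      ∃ (κ : Type u) (_ : Fintype κ) (i : D →ₗ[A] κ → V) (p : (κ → V) →ₗ[A] D),
        p ∘ₗ i = LinearMap.id)
    {a b : ℕ} (g : (Fin a → Λ) →ₗ[Λ] (Fin b → Λ)) : Module.Projective Λ (LinearMap.ker g) := by
  have hcomm : SMulCommClass Λ A V := SMulCommClass.symm _ _ _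
  let θ : Fin b → V →ₗ[A] (Fin a → V) := fun j ↦
    LinearMap.pi fun i ↦ Module.toModuleEnd A (S := Λ) V (g (Pi.single i 1) j)
  have hθ : ∀ j v i, θ j v i = g (Pi.single i 1) j • v := fun _ _ _ ↦ rfl
  let U : Submodule A (Fin a → V) := ⨆ j, LinearMap.range (θ j)
  obtain ⟨κ, _, i, p, hpi⟩ := hsummand ((Fin a → V) ⧸ U) (by
    intro c hc x
    obtain ⟨x, rfl⟩ := Submodule.mkQ_surjective _ x
    rw [← map_smul, show c • x = 0 from funext fun i ↦ hc _, map_zero])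
  have hproj := projective_linearMap hΛ i p hpi
  let lin : (Fin a → Λ) → ((Fin a → V) →ₗ[A] V) := fun r ↦
    ∑ i, Module.toModuleEnd A (S := Λ) V (r i) ∘ₗ LinearMap.proj i
  have hlin : ∀ r v, lin r v = ∑ i, r i • v i := fun r v ↦ by
    simp only [lin, LinearMap.sum_apply]
    rfl
  have hg : ∀ r j, g r j = ∑ i, r i * g (Pi.single i 1) j := by
    intro r j
    conv_lhs => rw [← Finset.univ_sum_single r, map_sum, Finset.sum_apply]
    refine Finset.sum_congr rfl fun i _ ↦ ?_
    rw [show (Pi.single i (r i) : Fin a → Λ) = r i • Pi.single i 1 by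
      rw [← Pi.single_smul, smul_eq_mul, mul_one], map_smul]
    rfl
  have hlinθ : ∀ r j v, lin r (θ j v) = g r j • v := by
    intro r j v
    rw [hlin, hg, Finset.sum_smul]
    exact Finset.sum_congr rfl fun i _ ↦ by rw [hθ, mul_smul]
  have hU : ∀ r ∈ LinearMap.ker g, U ≤ LinearMap.ker (lin r) := by
    intro r hr
    refine iSup_le fun j ↦ ?_
    rintro _ ⟨v, rfl⟩
    rw [LinearMap.mem_ker, hlinθ, LinearMap.mem_ker.1 hr, Pi.zero_apply, zero_smul]
  let E : LinearMap.ker g →ₗ[Λ] (((Fin a → V) ⧸ U) →ₗ[A] V) :=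
    { toFun := fun r ↦ U.liftQ (lin r.1) (hU r.1 r.2)
      map_add' := fun r s ↦ by
        refine Submodule.linearMap_qext _ (LinearMap.ext fun v ↦ ?_)
        simp [hlin, add_smul, Finset.sum_add_distrib]
      map_smul' := fun c r ↦ by
        refine Submodule.linearMap_qext _ (LinearMap.ext fun v ↦ ?_)
        simp [hlin, mul_smul, Finset.smul_sum] }
  have hE : ∀ r v, E r (U.mkQ v) = ∑ i, r.1 i • v i := fun r v ↦ hlin r.1 v
  have hbij : Function.Bijective E := by
    constructor
    · intro r s hrs
      ext i
      refine FaithfulSMul.eq_of_smul_eq_smul (α := V) fun v ↦ ?_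
      have h1 := LinearMap.congr_fun hrs (U.mkQ (Pi.single i v))
      rw [hE, hE] at h1
      simpa [Pi.single_apply, smul_ite] using h1
    · intro f
      choose r hr using fun i ↦ hΛ (f ∘ₗ U.mkQ ∘ₗ LinearMap.single A (fun _ ↦ V) i)
      have hrf : ∀ v, lin r v = f (U.mkQ v) := fun v ↦ by
        conv_rhs => rw [← Finset.univ_sum_single v, map_sum, map_sum]
        rw [hlin]
        exact Finset.sum_congr rfl fun i _ ↦ hr i (v i)
      have hrk : r ∈ LinearMap.ker g := by
        rw [LinearMap.mem_ker]
        ext j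
        refine FaithfulSMul.eq_of_smul_eq_smul (α := V) fun v ↦ ?_
        rw [← hlinθ, hrf, Pi.zero_apply, zero_smul, Submodule.mkQ_apply,
          (Submodule.Quotient.mk_eq_zero _).2 (le_iSup (fun j ↦ LinearMap.range (θ j)) j ⟨v, rfl⟩),
          map_zero]
      exact ⟨⟨r, hrk⟩, Submodule.linearMap_qext _ (LinearMap.ext fun v ↦ hrf v)⟩
  exact Module.Projective.of_equiv' (LinearEquiv.ofBijective E hbij).symm

theorem globalDimension_le_two_of_forall_projective_ker {Λ : Type v} [Ring Λ] [IsNoetherianRing Λ]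
    (h : ∀ (a b : ℕ) (g : (Fin a → Λ) →ₗ[Λ] (Fin b → Λ)), Module.Projective Λ (LinearMap.ker g)) :
    globalDimension Λ ≤ 2 := by
  refine iSup₂_le fun X hX ↦ ?_
  obtain ⟨b, f, hf⟩ := Module.Finite.exists_fin' Λ X
  obtain ⟨a, g, hg⟩ := Module.Finite.exists_fin' Λ (LinearMap.ker f)
  have hp := h a b ((LinearMap.ker f).subtype ∘ₗ g)
  rw [LinearMap.ker_comp, Submodule.ker_subtype] at hp
  refine (CategoryTheory.projectiveDimension_le_iff X 2).2 ?_
  exact (hasProjectiveDimensionLT_iff_ker hf 1).2 ((hasProjectiveDimensionLT_iff_ker hg 0).2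
    (hasProjectiveDimensionLT_one_iff.2 hp))

end Kernel

section Cyclic

variable {A : Type u} [CommRing A] [IsDomain A] [IsPrincipalIdealRing A] {ι : Type w} [Fintype ι]
  [DecidableEq ι] {h : ι → A}

/-- If every prime power dividing some `h i` is, up to units, one of the `h j`, then every finitely
generated module annihilated by the annihilator of `V` is a direct summand of a power of `V`. -/
theorem exists_retract_of_forall_associated (hne : ∀ j, h j ≠ 0)
    (hH : ∀ q, Prime q → ∀ k, 1 ≤ k → ∀ i, q ^ k ∣ h i → ∃ j, Associated (h j) (q ^ k))
    (D : Type*) [AddCommGroup D] [Module A D] [Module.Finite A D]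
    (hD : ∀ a : A, (∀ v : (j : ι) → A ⧸ Ideal.span {h j}, a • v = 0) → ∀ x : D, a • x = 0) :
    ∃ (κ : Type u) (_ : Fintype κ) (i : D →ₗ[A] κ → ((j : ι) → A ⧸ Ideal.span {h j}))
      (p : (κ → ((j : ι) → A ⧸ Ideal.span {h j})) →ₗ[A] D), p ∘ₗ i = LinearMap.id := by
  classical
  obtain ⟨χ, hχ0, hχ1, hχ2⟩ := exists_lcm h hne
  have hχD : ∀ x : D, χ • x = 0 := hD χ fun v ↦ by
    funext j
    obtain ⟨b, hb⟩ := hχ1 j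
    rw [hb, mul_comm, mul_smul, Pi.smul_apply, Pi.smul_apply,
      smul_quotient_span_singleton_eq_zero, smul_zero]
    rfl
  have htors : Module.IsTorsion A D := fun x ↦
    ⟨⟨χ, mem_nonZeroDivisors_of_ne_zero hχ0⟩, hχD x⟩
  obtain ⟨κ, _, p, hp, e, ⟨E⟩⟩ := Module.equiv_directSum_of_isTorsion htors
  let E' : D ≃ₗ[A] ((k : κ) → A ⧸ Ideal.span {p k ^ e k}) :=
    E.trans (DirectSum.linearEquivFunOnFintype _ _ _)
  have hretr : ∀ k, ∃ (i : (A ⧸ Ideal.span {p k ^ e k}) →ₗ[A] ((j : ι) → A ⧸ Ideal.span {h j}))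
      (q : ((j : ι) → A ⧸ Ideal.span {h j}) →ₗ[A] (A ⧸ Ideal.span {p k ^ e k})),
      ∀ x, q (i x) = x := by
    intro k
    rcases Nat.eq_zero_or_pos (e k) with hk | hk
    · have : Subsingleton (A ⧸ Ideal.span {p k ^ e k}) := by
        rw [Ideal.Quotient.subsingleton_iff, hk, pow_zero, Ideal.span_singleton_one]
      exact ⟨0, 0, fun x ↦ Subsingleton.elim _ _⟩
    · have hdvd : p k ^ e k ∣ χ := by
        have h1 := hχD (E'.symm (Pi.single k 1))
        rw [← map_smul, LinearEquiv.map_eq_zero_iff, ← Pi.single_smul, Pi.single_eq_zero_iff,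
          Algebra.smul_def, mul_one] at h1
        exact (Ideal.Quotient.eq_zero_iff_dvd _ _).1 h1
      obtain ⟨i, hi⟩ := hχ2 _ (hp k).prime _ hk hdvd
      obtain ⟨j, hj⟩ := hH _ (hp k).prime _ hk i hi
      let F := Submodule.quotEquivOfEq _ _ (Ideal.span_singleton_eq_span_singleton.2 hj)
      refine ⟨LinearMap.single A (fun j ↦ A ⧸ Ideal.span {h j}) j ∘ₗ F.symm.toLinearMap,
        F.toLinearMap ∘ₗ LinearMap.proj j, fun x ↦ ?_⟩
      simp
  choose i q hq using hretr
  refine ⟨κ, inferInstance, (LinearMap.pi fun k ↦ i k ∘ₗ LinearMap.proj k) ∘ₗ E'.toLinearMap,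
    E'.symm.toLinearMap ∘ₗ (LinearMap.pi fun k ↦ q k ∘ₗ LinearMap.proj k),
    LinearMap.ext fun x ↦ ?_⟩
  simp only [LinearMap.comp_apply, LinearEquiv.coe_coe, LinearMap.id_apply]
  rw [LinearEquiv.symm_apply_eq]
  funext k
  exact hq k _

theorem globalDimension_le_two_of_forall_associated {Λ : Type v} [Ring Λ] [IsNoetherianRing Λ]
    {ι : Type} [Fintype ι] [DecidableEq ι] {h : ι → A}
    [Module Λ ((j : ι) → A ⧸ Ideal.span {h j})] [SMulCommClass A Λ ((j : ι) → A ⧸ Ideal.span {h j})]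
    [FaithfulSMul Λ ((j : ι) → A ⧸ Ideal.span {h j})]
    (hΛ : ∀ φ : Module.End A ((j : ι) → A ⧸ Ideal.span {h j}), ∃ r : Λ, ∀ v, r • v = φ v)
    (hne : ∀ j, h j ≠ 0)
    (hH : ∀ q, Prime q → ∀ k, 1 ≤ k → ∀ i, q ^ k ∣ h i → ∃ j, Associated (h j) (q ^ k)) :
    globalDimension Λ ≤ 2 :=
  globalDimension_le_two_of_forall_projective_ker fun _ _ g ↦
    projective_ker_of_forall_summand hΛ
      (fun D _ _ _ hD ↦ exists_retract_of_forall_associated hne hH D hD) g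

end Cyclic

/-! ### Multiplicities of simple modules as lengths of corners -/

section Corner

variable (A : Type u) {Λ : Type v} [CommRing A] [Ring Λ] [Algebra A Λ]

/-- The part `e X` of a `Λ`-module `X` cut out by an idempotent `e` of an `A`-algebra `Λ`, as an
`A`-module. It is described as the set of fixed points of `e`. -/
def corner (e : Λ) (X : Type*) [AddCommGroup X] [Module A X] [Module Λ X] [IsScalarTower A Λ X] :
    Submodule A X where
  carrier := {x | e • x = x}
  add_mem' {x y} hx hy := by
    change e • (x + y) = x + y
    rw [smul_add, hx, hy]
  zero_mem' := smul_zero e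
  smul_mem' a x hx := by
    change e • a • x = a • x
    rw [smul_comm, hx]

variable {A} in
theorem mem_corner {e : Λ} {X : Type*} [AddCommGroup X] [Module A X] [Module Λ X]
    [IsScalarTower A Λ X] {x : X} : x ∈ corner A e X ↔ e • x = x := Iff.rfl

/-- The length of `e X` over `A`, where `A` acts on `X` through `Λ`. -/
noncomputable def cornerLength (e : Λ) (X : Type*) [AddCommGroup X] [Module Λ X] : ℕ∞ :=
  letI := Module.compHom X (algebraMap A Λ)
  haveI : IsScalarTower A Λ X := ⟨fun a r x ↦ by
    rw [Algebra.smul_def, mul_smul]; rfl⟩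
  Module.length A (corner A e X)

theorem cornerLength_eq (e : Λ) (X : Type*) [AddCommGroup X] [i : Module A X] [Module Λ X]
    [IsScalarTower A Λ X] : cornerLength A e X = Module.length A (corner A e X) := by
  obtain ⟨L, hL⟩ : ∃ L, L = Module.length A (corner A e X) := ⟨_, rfl⟩
  have h : ∀ (i' : Module A X) (_ : i' = i) (_ : IsScalarTower A Λ X),
      Module.length A (@corner A _ _ _ _ e X _ i' _ _) = L := by
    rintro i' rfl _
    exact hL.symm
  rw [← hL]
  exact h (Module.compHom X (algebraMap A Λ)) (Module.ext' _ _ fun a x ↦ by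
    change algebraMap A Λ a • x = a • x
    exact algebraMap_smul Λ a x) _

variable {e : Λ} {X Y : Type*} [AddCommGroup X] [Module Λ X] [AddCommGroup Y] [Module Λ Y]

theorem cornerLength_congr (f : X ≃ₗ[Λ] Y) : cornerLength A e X = cornerLength A e Y := by
  let _ := Module.compHom X (algebraMap A Λ)
  let _ := Module.compHom Y (algebraMap A Λ)
  have hX : IsScalarTower A Λ X := ⟨fun a r x ↦ by rw [Algebra.smul_def, mul_smul]; rfl⟩
  have hY : IsScalarTower A Λ Y := ⟨fun a r x ↦ by rw [Algebra.smul_def, mul_smul]; rfl⟩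
  rw [cornerLength_eq, cornerLength_eq]
  let g : X ≃ₗ[A] Y := f.restrictScalars A
  have hg : ∀ x, g x = f x := fun _ ↦ rfl
  refine (g.ofSubmodules (corner A e X) (corner A e Y) ?_).length_eq
  ext y
  rw [Submodule.mem_map_equiv, mem_corner, mem_corner]
  constructor
  · intro h
    have := congrArg f h
    rwa [map_smul, ← hg, LinearEquiv.apply_symm_apply] at this
  · intro h
    apply f.injective
    rw [map_smul, ← hg, LinearEquiv.apply_symm_apply, h]

theorem cornerLength_of_subsingleton [Subsingleton X] : cornerLength A e X = 0 := by
  let _ := Module.compHom X (algebraMap A Λ)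
  have hX : IsScalarTower A Λ X := ⟨fun a r x ↦ by rw [Algebra.smul_def, mul_smul]; rfl⟩
  rw [cornerLength_eq]
  exact Module.length_eq_zero

theorem cornerLength_add (he : e * e = e) (N : Submodule Λ X) :
    cornerLength A e X = cornerLength A e N + cornerLength A e (X ⧸ N) := by
  let _ := Module.compHom X (algebraMap A Λ)
  have hX : IsScalarTower A Λ X := ⟨fun a r x ↦ by rw [Algebra.smul_def, mul_smul]; rfl⟩
  rw [cornerLength_eq, cornerLength_eq, cornerLength_eq]
  let f : corner A e N →ₗ[A] corner A e X := (N.subtype.restrictScalars A).restrict (by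
    intro x hx
    exact congrArg Subtype.val (mem_corner.1 hx))
  let g : corner A e X →ₗ[A] corner A e (X ⧸ N) := (N.mkQ.restrictScalars A).restrict (by
    intro x hx
    exact congrArg N.mkQ (mem_corner.1 hx))
  have hf : ∀ x, (f x : X) = x.1 := fun _ ↦ rfl
  have hg : ∀ x, (g x : X ⧸ N) = N.mkQ x := fun _ ↦ rfl
  refine Module.length_eq_add_of_exact f g ?_ ?_ ?_
  · intro x y hxy
    have := congrArg Subtype.val hxy
    rw [hf, hf] at this
    exact Subtype.ext (Subtype.ext this)
  · rintro ⟨y, hy⟩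
    obtain ⟨x, rfl⟩ := N.mkQ_surjective y
    refine ⟨⟨e • x, ?_⟩, Subtype.ext ?_⟩
    · rw [mem_corner, ← mul_smul, he]
    · rw [hg, map_smul]
      exact hy
  · intro x
    constructor
    · intro h
      have h1 : N.mkQ x.1 = 0 := by rw [← hg, h]; rfl
      have h2 : x.1 ∈ N := (Submodule.Quotient.mk_eq_zero N).1 h1
      exact ⟨⟨⟨x.1, h2⟩, mem_corner.2 (Subtype.ext x.2)⟩, rfl⟩
    · rintro ⟨y, rfl⟩
      apply Subtype.ext
      rw [hg, hf]
      exact (Submodule.Quotient.mk_eq_zero N).2 y.1.2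

theorem cornerLength_eq_zero (h : ∀ x : X, e • x = x → x = 0) : cornerLength A e X = 0 := by
  let _ := Module.compHom X (algebraMap A Λ)
  have hX : IsScalarTower A Λ X := ⟨fun a r x ↦ by rw [Algebra.smul_def, mul_smul]; rfl⟩
  rw [cornerLength_eq, Module.length_eq_zero_iff]
  exact ⟨fun x y ↦ Subtype.ext ((h _ x.2).trans (h _ y.2).symm)⟩

/-- If `e Λ e` consists of the multiples of `e` by elements of `A`, then `e T` is zero or simple
for every simple module `T`. -/
theorem cornerLength_eq_one [IsSimpleModule Λ X] (hloc : ∀ r : Λ, ∃ a : A, e * r * e = a • e)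
    {x : X} (hx : e • x = x) (hx0 : x ≠ 0) : cornerLength A e X = 1 := by
  let _ := Module.compHom X (algebraMap A Λ)
  have hX : IsScalarTower A Λ X := ⟨fun a r x ↦ by rw [Algebra.smul_def, mul_smul]; rfl⟩
  rw [cornerLength_eq, Module.length_eq_one_iff]
  have hnt : Nontrivial (corner A e X) := ⟨⟨x, hx⟩, 0, fun h ↦ hx0 (congrArg Subtype.val h)⟩
  rw [isSimpleModule_iff_toSpanSingleton_surjective]
  refine ⟨hnt, fun y hy z ↦ ?_⟩
  have hy0 : y.1 ≠ 0 := fun h ↦ hy (Subtype.ext h)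
  obtain ⟨r, hr⟩ := IsSimpleModule.toSpanSingleton_surjective Λ hy0 z.1
  obtain ⟨a, ha⟩ := hloc r
  refine ⟨a, Subtype.ext ?_⟩
  have hr : r • y.1 = z.1 := hr
  change a • y.1 = z.1
  rw [← mem_corner.1 z.2, ← hr, ← mem_corner.1 y.2, ← smul_assoc, ← ha, mul_smul, mul_smul]

theorem apply_last_eq_add_sum {M : Type*} [AddCommMonoid M] {n : ℕ} (f : Fin (n + 1) → M)
    (g : Fin n → M) (h : ∀ i : Fin n, f i.succ = f i.castSucc + g i) :
    f (Fin.last n) = f 0 + ∑ i, g i := by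
  induction n with
  | zero => simp
  | succ n ih =>
    have h1 : f (Fin.last n).castSucc = f 0 + ∑ i : Fin n, g i.castSucc :=
      ih (fun i ↦ f i.castSucc) (fun i ↦ g i.castSucc) fun i ↦ h i.castSucc
    rw [Fin.sum_univ_castSucc, ← add_assoc, ← h1, ← h (Fin.last n), Fin.succ_last]

theorem cornerLength_eq_sum (he : e * e = e) (s : CompositionSeries (Submodule Λ X))
    (h0 : s.head = ⊥) (h1 : s.last = ⊤) : cornerLength A e X =
      ∑ i : Fin s.length, cornerLength A e (s i.succ ⧸ (s i.castSucc).submoduleOf (s i.succ)) := by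
  have h := apply_last_eq_add_sum (fun i : Fin (s.length + 1) ↦ cornerLength A e (s i)) _
    fun i : Fin s.length ↦ by
      rw [cornerLength_add A he ((s i.castSucc).submoduleOf (s i.succ)),
        cornerLength_congr A (Submodule.submoduleOfEquivOfLe (s.step i).le)]
  have hl : s (Fin.last _) = ⊤ := h1
  have hb : s 0 = ⊥ := h0
  have h2 : cornerLength A e (s 0) = 0 := by
    rw [hb]
    exact cornerLength_of_subsingleton A
  rw [h2, zero_add] at h
  rw [← h, cornerLength_congr A Submodule.topEquiv.symm]
  change _ = cornerLength A e (s (Fin.last _))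
  rw [hl]

/-- If `T` is the only simple module with `e T ≠ 0`, then the length of `e X` is the multiplicity
of `T` in `X`. -/
theorem HasMultiplicity.cornerLength_eq {T : Type*} [AddCommGroup T] [Module Λ T]
    [IsSimpleModule Λ T] {k : ℕ} (hk : HasMultiplicity Λ X T k) (he : e * e = e)
    (hloc : ∀ r : Λ, ∃ a : A, e * r * e = a • e) {t : T} (ht : e • t = t) (ht0 : t ≠ 0)
    (huniq : ∀ (N : Submodule Λ X) (N' : Submodule Λ N), IsSimpleModule Λ (N ⧸ N') →
      ∀ x : N ⧸ N', e • x = x → x ≠ 0 → Nonempty ((N ⧸ N') ≃ₗ[Λ] T)) :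
    cornerLength A e X = k := by
  classical
  obtain ⟨s, h0, h1, rfl⟩ := hk
  rw [cornerLength_eq_sum A he s h0 h1, Nat.card_eq_fintype_card, Fintype.card_subtype,
    Finset.card_filter, Nat.cast_sum]
  refine Finset.sum_congr rfl fun i _ ↦ ?_
  have hs : IsSimpleModule Λ (s i.succ ⧸ (s i.castSucc).submoduleOf (s i.succ)) :=
    (covBy_iff_quot_is_simple (s.step i).le).mp (s.step i)
  split_ifs with h
  · obtain ⟨f⟩ := h
    rw [cornerLength_congr A f, cornerLength_eq_one A hloc ht ht0, Nat.cast_one]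
  · rw [Nat.cast_zero]
    refine cornerLength_eq_zero A fun x hx ↦ ?_
    by_contra hx0
    exact h (huniq _ _ hs x hx hx0)

end Corner

section Local

variable {A : Type u} {Λ : Type v} [CommRing A] [IsPrincipalIdealRing A] [Ring Λ]
  [Algebra A Λ] {e : Λ} {p : A} {k : ℕ} {T T' : Type*} [AddCommGroup T] [Module Λ T]
  [AddCommGroup T'] [Module Λ T']

theorem dvd_of_smul_eq_zero (hp : Irreducible p) (hk : p ^ k • e = 0) {a : A} {x : T}
    (hx : e • x = x) (hx0 : x ≠ 0) (ha : (a • e) • x = 0) : p ∣ a := by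
  by_contra hpa
  obtain ⟨b, c, hbc⟩ := ((hp.coprime_iff_not_dvd.2 hpa).pow_left (m := k)).symm
  apply hx0
  rw [← hx, ← one_smul A e, ← hbc, add_smul, mul_smul, mul_smul, hk, smul_zero, add_zero,
    Algebra.smul_def, mul_smul, ha, smul_zero]

theorem smul_eq_zero_of_corner [IsSimpleModule Λ T']
    (hloc : ∀ r : Λ, ∃ a : A, e * r * e = a • e) (hp : Irreducible p) (hk : p ^ k • e = 0)
    {x : T} (hx : e • x = x) (hx0 : x ≠ 0) {x' : T'} (hx' : e • x' = x') (hx0' : x' ≠ 0) (r : Λ)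
    (hr : r • x = 0) : r • x' = 0 := by
  by_contra hr'
  obtain ⟨s, hs⟩ := IsSimpleModule.toSpanSingleton_surjective Λ hr' x'
  have hs : s • r • x' = x' := hs
  obtain ⟨a, ha⟩ := hloc (s * r)
  have h1 : p ∣ a := dvd_of_smul_eq_zero hp hk hx hx0 (by
    rw [← ha, mul_smul, mul_smul, hx, mul_smul, hr, smul_zero, smul_zero])
  have h2 : p ∣ a - 1 := dvd_of_smul_eq_zero hp hk hx' hx0' (by
    rw [sub_smul, one_smul, ← ha, sub_smul, mul_smul, mul_smul, hx', mul_smul, hs, hx', sub_self])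
  have h3 := dvd_sub h1 h2
  rw [sub_sub_cancel] at h3
  exact hp.not_isUnit (isUnit_of_dvd_one h3)

/-- If `e Λ e` is a quotient of `A / p ^ k`, then there is at most one simple module `T` with
`e T ≠ 0`. -/
theorem nonempty_linearEquiv_of_corner [IsSimpleModule Λ T] [IsSimpleModule Λ T']
    (hloc : ∀ r : Λ, ∃ a : A, e * r * e = a • e) (hp : Irreducible p) (hk : p ^ k • e = 0)
    {x : T} (hx : e • x = x) (hx0 : x ≠ 0) {x' : T'} (hx' : e • x' = x') (hx0' : x' ≠ 0) :
    Nonempty (T ≃ₗ[Λ] T') := by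
  have hker : LinearMap.ker (LinearMap.toSpanSingleton Λ T x) =
      LinearMap.ker (LinearMap.toSpanSingleton Λ T' x') := by
    ext r
    exact ⟨smul_eq_zero_of_corner hloc hp hk hx hx0 hx' hx0' r,
      smul_eq_zero_of_corner hloc hp hk hx' hx0' hx hx0 r⟩
  exact ⟨((LinearMap.quotKerEquivOfSurjective _
    (IsSimpleModule.toSpanSingleton_surjective Λ hx0)).symm.trans
      (Submodule.quotEquivOfEq _ _ hker)).trans (LinearMap.quotKerEquivOfSurjective _
        (IsSimpleModule.toSpanSingleton_surjective Λ hx0'))⟩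

/-- If `e T ≠ 0`, then the projective cover of the simple module `T` is isomorphic to `Λ e`. -/
theorem IsProjectiveCover.exists_generator {P : Type*} [AddCommGroup P] [Module Λ P]
    [IsSimpleModule Λ T] {π : P →ₗ[Λ] T} (hπ : IsProjectiveCover π) (he : e * e = e)
    (hloc : ∀ r : Λ, ∃ a : A, e * r * e = a • e) (hp : Irreducible p) (hk : p ^ k • e = 0)
    {x : T} (hx : e • x = x) (hx0 : x ≠ 0) :
    ∃ y : P, e • y = y ∧ (∀ z : P, ∃ r : Λ, r • y = z) ∧ ∀ r : Λ, r • y = 0 → r * e = 0 := by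
  obtain ⟨y₀, hy₀⟩ := hπ.surjective x
  let y := e • y₀
  have hy : e • y = y := by rw [← mul_smul, he]
  have hπy : π y = x := by rw [map_smul, hy₀, hx]
  have hgen : Function.Surjective (LinearMap.toSpanSingleton Λ P y) := by
    rw [← LinearMap.range_eq_top]
    apply hπ.superfluous
    rw [eq_top_iff]
    intro z _
    obtain ⟨r, hr⟩ := IsSimpleModule.toSpanSingleton_surjective Λ hx0 (π z)
    have hr : r • x = π z := hr
    rw [← add_sub_cancel (r • y) z]
    refine Submodule.add_mem_sup ⟨r, rfl⟩ ?_
    rw [LinearMap.mem_ker, map_sub, map_smul, hπy, hr, sub_self]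
  have := hπ.projective
  obtain ⟨s, hs⟩ := Module.projective_lifting_property _ LinearMap.id hgen
  refine ⟨y, hy, hgen, fun r hr ↦ ?_⟩
  have hsy : s y • y = y := LinearMap.congr_fun hs y
  obtain ⟨a, ha⟩ := hloc (s y)
  have hse : e * s y = s y := by rw [← smul_eq_mul, ← map_smul, hy]
  rw [hse] at ha
  -- `s y * e = a • e` with `a` prime to `p`, since otherwise `y = 0`.
  have hy0 : y ≠ 0 := fun h ↦ hx0 (by rw [← hπy, h, map_zero])
  have hpa : ¬ p ∣ a := by
    intro hpa
    have h2 : p ∣ a - 1 := dvd_of_smul_eq_zero hp hk hy hy0 (by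
      rw [sub_smul, one_smul, ← ha, sub_smul, mul_smul, hy, hsy, sub_self])
    have h3 := dvd_sub hpa h2
    rw [sub_sub_cancel] at h3
    exact hp.not_isUnit (isUnit_of_dvd_one h3)
  have h1 : a • (r * e) = 0 := by
    rw [← mul_smul_comm, ← ha, ← mul_assoc, ← smul_eq_mul r, ← map_smul, hr, map_zero, zero_mul]
  obtain ⟨b, c, hbc⟩ := ((hp.coprime_iff_not_dvd.2 hpa).pow_left (m := k)).symm
  rw [← one_smul A (r * e), ← hbc, add_smul, mul_smul, h1, smul_zero, mul_smul, ← mul_smul_comm,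
    hk, mul_zero, smul_zero, add_zero]

end Local

/-! ### Lengths of homomorphism modules between primary cyclic modules -/

section Length

variable {A : Type u} [CommRing A] [IsDomain A] [IsPrincipalIdealRing A]

theorem length_quotient_span_pow {p : A} (hp : Irreducible p) (k : ℕ) :
    Module.length A (A ⧸ Ideal.span {p ^ k}) = k := by
  induction k with
  | zero =>
    have : Subsingleton (A ⧸ Ideal.span {p ^ 0}) := by
      rw [Ideal.Quotient.subsingleton_iff, pow_zero, Ideal.span_singleton_one]
    rw [Module.length_eq_zero, Nat.cast_zero]
  | succ k ih =>
    have h1 : p ^ k • p • (1 : A ⧸ Ideal.span {p ^ (k + 1)}) = 0 := by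
      rw [smul_smul, ← pow_succ, smul_quotient_span_singleton_eq_zero]
    have h2 : p • (1 : A ⧸ Ideal.span {p}) = 0 := smul_quotient_span_singleton_eq_zero _ _
    have hle : Ideal.span {p ^ (k + 1)} ≤ Ideal.span {p} :=
      Ideal.span_singleton_le_span_singleton.2 (dvd_pow_self p (by omega))
    let f : (A ⧸ Ideal.span {p ^ k}) →ₗ[A] A ⧸ Ideal.span {p ^ (k + 1)} := liftTorsion _ h1
    let g : (A ⧸ Ideal.span {p ^ (k + 1)}) →ₗ[A] A ⧸ Ideal.span {p} := Submodule.factor hle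
    have hf : ∀ a, f (Ideal.Quotient.mk _ a) = Ideal.Quotient.mk _ (a * p) := fun a ↦ by
      rw [liftTorsion_mk, smul_smul, Algebra.smul_def, mul_one]
      rfl
    have hg : ∀ a, g (Ideal.Quotient.mk _ a) = Ideal.Quotient.mk _ a := fun _ ↦ rfl
    rw [Module.length_eq_add_of_exact f g ?_ ?_ ?_, ih]
    · have : (Ideal.span {p}).IsMaximal := PrincipalIdealRing.isMaximal_of_irreducible hp
      have hs : IsSimpleModule A (A ⧸ Ideal.span {p}) := isSimpleModule_iff_isCoatom.2 this.out
      rw [Module.length_eq_one, Nat.cast_add, Nat.cast_one]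
    · rw [injective_iff_map_eq_zero]
      intro x hx
      obtain ⟨a, rfl⟩ := Ideal.Quotient.mk_surjective x
      rw [hf, Ideal.Quotient.eq_zero_iff_dvd, pow_succ, mul_dvd_mul_iff_right hp.ne_zero] at hx
      exact (Ideal.Quotient.eq_zero_iff_dvd _ _).2 hx
    · intro x
      obtain ⟨a, rfl⟩ := Ideal.Quotient.mk_surjective x
      exact ⟨_, hg a⟩
    · intro x
      obtain ⟨a, rfl⟩ := Ideal.Quotient.mk_surjective x
      rw [hg, Ideal.Quotient.eq_zero_iff_dvd]
      constructor
      · rintro ⟨b, rfl⟩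
        exact ⟨Ideal.Quotient.mk _ b, by rw [hf, mul_comm]⟩
      · rintro ⟨y, hy⟩
        obtain ⟨b, rfl⟩ := Ideal.Quotient.mk_surjective y
        rw [hf, Ideal.Quotient.eq, Ideal.mem_span_singleton] at hy
        have h3 := (dvd_pow_self p (by omega : k + 1 ≠ 0)).trans hy
        have h4 := dvd_sub (dvd_mul_left p b) h3
        rwa [sub_sub_cancel] at h4

/-- `Hom (A / p ^ a, A / p ^ b)`, realised as the elements of `A / p ^ b` killed by `p ^ a`, has
length `min a b`. -/
theorem length_torsionBy_pow {p : A} (hp : Irreducible p) (a b : ℕ) :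
    Module.length A (Submodule.torsionBy A (A ⧸ Ideal.span {p ^ b}) (p ^ a)) = (min a b : ℕ) := by
  rcases le_total b a with hab | hab
  · have h1 : Submodule.torsionBy A (A ⧸ Ideal.span {p ^ b}) (p ^ a) = ⊤ := by
      rw [eq_top_iff]
      intro x _
      rw [Submodule.mem_torsionBy_iff, ← Nat.sub_add_cancel hab, pow_add, mul_smul,
        smul_quotient_span_singleton_eq_zero, smul_zero]
    rw [h1, Module.length_top, length_quotient_span_pow hp, min_eq_right hab]
  · have h1 : p ^ a • p ^ (b - a) • (1 : A ⧸ Ideal.span {p ^ b}) = 0 := by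
      rw [smul_smul, ← pow_add, Nat.add_sub_cancel' hab, smul_quotient_span_singleton_eq_zero]
    have hb : p ^ b = p ^ a * p ^ (b - a) := by rw [← pow_add, Nat.add_sub_cancel' hab]
    let f : (A ⧸ Ideal.span {p ^ a}) →ₗ[A] Submodule.torsionBy A (A ⧸ Ideal.span {p ^ b}) (p ^ a) :=
      liftTorsion ⟨_, h1⟩ (Subtype.ext h1)
    have hf : ∀ c, (f (Ideal.Quotient.mk _ c)).1 = Ideal.Quotient.mk _ (c * p ^ (b - a)) := by
      intro c
      rw [liftTorsion_mk, Submodule.coe_smul, smul_smul, Algebra.smul_def, mul_one]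
      rfl
    have hbij : Function.Bijective f := by
      constructor
      · rw [injective_iff_map_eq_zero]
        intro x hx
        obtain ⟨c, rfl⟩ := Ideal.Quotient.mk_surjective x
        have h2 := congrArg Subtype.val hx
        rw [hf, Submodule.coe_zero, Ideal.Quotient.eq_zero_iff_dvd, hb,
          mul_dvd_mul_iff_right (pow_ne_zero _ hp.ne_zero)] at h2
        exact (Ideal.Quotient.eq_zero_iff_dvd _ _).2 h2
      · rintro ⟨y, hy⟩
        obtain ⟨c, rfl⟩ := Ideal.Quotient.mk_surjective y
        rw [Submodule.mem_torsionBy_iff, Algebra.smul_def, Ideal.Quotient.algebraMap_eq,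
          ← map_mul, Ideal.Quotient.eq_zero_iff_dvd, hb,
          mul_dvd_mul_iff_left (pow_ne_zero _ hp.ne_zero)] at hy
        obtain ⟨d, rfl⟩ := hy
        exact ⟨Ideal.Quotient.mk _ d, Subtype.ext (by rw [hf, mul_comm])⟩
    rw [← (LinearEquiv.ofBijective f hbij).length_eq, length_quotient_span_pow hp,
      min_eq_left hab]

omit [IsDomain A] [IsPrincipalIdealRing A] in
theorem length_torsionBy_of_isCoprime {q h : A} (hqh : IsCoprime q h) :
    Module.length A (Submodule.torsionBy A (A ⧸ Ideal.span {h}) q) = 0 := by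
  rw [Module.length_eq_zero_iff]
  obtain ⟨b, c, hbc⟩ := hqh
  suffices H : ∀ x : Submodule.torsionBy A (A ⧸ Ideal.span {h}) q, x = 0 from
    ⟨fun x y ↦ (H x).trans (H y).symm⟩
  rintro ⟨x, hx⟩
  rw [Submodule.mem_torsionBy_iff] at hx
  apply Subtype.ext
  change x = 0
  rw [← one_smul A x, ← hbc, add_smul, mul_smul, hx, mul_smul,
    smul_quotient_span_singleton_eq_zero, smul_zero, smul_zero, add_zero]

end Length

/-! ### Simple and projective modules over the endomorphism algebra of a sum of cyclic modules -/

section Cyclic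

variable {A : Type u} [CommRing A] {Λ : Type v} [Ring Λ] [Algebra A Λ]
  {ι : Type w} [DecidableEq ι] {h : ι → A}
  [Module Λ ((j : ι) → A ⧸ Ideal.span {h j})] [IsScalarTower A Λ ((j : ι) → A ⧸ Ideal.span {h j})]
  [FaithfulSMul Λ ((j : ι) → A ⧸ Ideal.span {h j})] {e : ι → Λ}

omit [Algebra A Λ]
  [IsScalarTower A Λ ((j : ι) → A ⧸ Ideal.span {h j})] in
theorem projector_mul_self (he : ∀ j (v : (j : ι) → A ⧸ Ideal.span {h j}),
    e j • v = Pi.single j (v j)) (j : ι) : e j * e j = e j := by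
  refine FaithfulSMul.eq_of_smul_eq_smul (α := (j : ι) → A ⧸ Ideal.span {h j}) fun v ↦ ?_
  rw [mul_smul, he, he, Pi.single_eq_same]

omit [Algebra A Λ] [IsScalarTower A Λ ((j : ι) → A ⧸ Ideal.span {h j})] in
theorem sum_projector [Fintype ι] (he : ∀ j (v : (j : ι) → A ⧸ Ideal.span {h j}),
    e j • v = Pi.single j (v j)) : ∑ j, e j = 1 := by
  refine FaithfulSMul.eq_of_smul_eq_smul (α := (j : ι) → A ⧸ Ideal.span {h j}) fun v ↦ ?_
  rw [Finset.sum_smul, one_smul]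
  simp only [he, Finset.univ_sum_single]

omit [Algebra A Λ]
  [IsScalarTower A Λ ((j : ι) → A ⧸ Ideal.span {h j})]
  [FaithfulSMul Λ ((j : ι) → A ⧸ Ideal.span {h j})] in
theorem projector_smul (he : ∀ j (v : (j : ι) → A ⧸ Ideal.span {h j}),
    e j • v = Pi.single j (v j)) (j : ι) (v : (j : ι) → A ⧸ Ideal.span {h j}) {c : A}
    (hc : Ideal.Quotient.mk _ c = v j) : e j • v = c • cyclicGen h j := by
  rw [he, cyclicGen, ← Pi.single_smul, ← hc, Algebra.smul_def, mul_one]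
  rfl

theorem mul_projector_ext (he : ∀ j (v : (j : ι) → A ⧸ Ideal.span {h j}),
    e j • v = Pi.single j (v j)) {j : ι} {r s : Λ}
    (hrs : r • cyclicGen h j = s • cyclicGen h j) : r * e j = s * e j := by
  refine FaithfulSMul.eq_of_smul_eq_smul (α := (j : ι) → A ⧸ Ideal.span {h j}) fun v ↦ ?_
  obtain ⟨c, hc⟩ := Ideal.Quotient.mk_surjective (v j)
  rw [mul_smul, mul_smul, projector_smul he j v hc, smul_comm r, smul_comm s, hrs]

omit [Algebra A Λ]
  [IsScalarTower A Λ ((j : ι) → A ⧸ Ideal.span {h j})]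
  [FaithfulSMul Λ ((j : ι) → A ⧸ Ideal.span {h j})] in
theorem projector_smul_cyclicGen (he : ∀ j (v : (j : ι) → A ⧸ Ideal.span {h j}),
    e j • v = Pi.single j (v j)) (j : ι) : e j • cyclicGen h j = cyclicGen h j := by
  rw [he, cyclicGen, Pi.single_eq_same]

theorem exists_projector_mul_mul_projector (he : ∀ j (v : (j : ι) → A ⧸ Ideal.span {h j}),
    e j • v = Pi.single j (v j)) (j : ι) (r : Λ) : ∃ a : A, e j * r * e j = a • e j := by
  obtain ⟨a, ha⟩ := Ideal.Quotient.mk_surjective ((r • cyclicGen h j) j)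
  refine ⟨a, ?_⟩
  rw [mul_projector_ext he (s := algebraMap A Λ a), ← Algebra.smul_def]
  rw [mul_smul, projector_smul he j _ ha, algebraMap_smul]

theorem smul_projector_eq_zero_iff (he : ∀ j (v : (j : ι) → A ⧸ Ideal.span {h j}),
    e j • v = Pi.single j (v j)) (j : ι) (a : A) : a • e j = 0 ↔ h j ∣ a := by
  rw [← Ideal.Quotient.eq_zero_iff_dvd]
  constructor
  · intro ha
    have h1 := congrFun (congrArg (· • cyclicGen h j) ha) j
    simp only [zero_smul, smul_assoc, projector_smul_cyclicGen he] at h1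
    rw [cyclicGen, Pi.smul_apply, Pi.single_eq_same, Algebra.smul_def, mul_one] at h1
    exact h1
  · intro ha
    rw [Algebra.smul_def, mul_projector_ext he (s := 0), zero_mul]
    rw [algebraMap_smul, zero_smul, cyclicGen, ← Pi.single_smul, Algebra.smul_def, mul_one]
    exact (congrArg _ ha).trans (Pi.single_zero _)

omit [Algebra A Λ] [IsScalarTower A Λ ((j : ι) → A ⧸ Ideal.span {h j})] in
theorem exists_projector_smul_ne_zero [Fintype ι] (he : ∀ j (v : (j : ι) → A ⧸ Ideal.span {h j}),
    e j • v = Pi.single j (v j)) (T : Type*) [AddCommGroup T] [Module Λ T] [Nontrivial T] :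
    ∃ j, ∃ x : T, e j • x = x ∧ x ≠ 0 := by
  obtain ⟨x, hx⟩ := exists_ne (0 : T)
  have h1 : ∃ j, e j • x ≠ 0 := by
    by_contra! hcon
    apply hx
    rw [← one_smul Λ x, ← sum_projector he, Finset.sum_smul]
    exact Finset.sum_eq_zero fun j _ ↦ hcon j
  obtain ⟨j, hj⟩ := h1
  exact ⟨j, e j • x, by rw [← mul_smul, projector_mul_self he], hj⟩

theorem exists_simple_of_projector (he : ∀ j (v : (j : ι) → A ⧸ Ideal.span {h j}),
    e j • v = Pi.single j (v j)) (j : ι) (hj : ¬ IsUnit (h j)) :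
    ∃ M : Submodule Λ Λ, IsSimpleModule Λ (Λ ⧸ M) ∧ ∃ x : Λ ⧸ M, e j • x = x ∧ x ≠ 0 := by
  have hne : LinearMap.ker (LinearMap.toSpanSingleton Λ Λ (e j)) ≠ ⊤ := by
    intro htop
    have h1 : (1 : Λ) ∈ LinearMap.ker (LinearMap.toSpanSingleton Λ Λ (e j)) := htop ▸ trivial
    rw [LinearMap.mem_ker, LinearMap.toSpanSingleton_apply, one_smul] at h1
    exact hj (isUnit_of_dvd_one ((smul_projector_eq_zero_iff he j 1).1 (by rw [h1, smul_zero])))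
  obtain ⟨M, hM, hle⟩ := Ideal.exists_le_maximal _ hne
  refine ⟨M, isSimpleModule_iff_isCoatom.2 hM.out, Submodule.Quotient.mk 1, ?_, ?_⟩
  · rw [← Submodule.Quotient.mk_smul, smul_eq_mul, mul_one, eq_comm, Submodule.Quotient.eq]
    apply hle
    rw [LinearMap.mem_ker, LinearMap.toSpanSingleton_apply, smul_eq_mul, sub_mul, one_mul,
      projector_mul_self he, sub_self]
  · rw [Ne, Submodule.Quotient.mk_eq_zero]
    exact fun h1 ↦ hM.ne_top ((Ideal.eq_top_iff_one _).2 h1)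

theorem exists_projector_smul_ne_zero_of_associated
    (hΛ : ∀ φ : Module.End A ((j : ι) → A ⧸ Ideal.span {h j}), ∃ r : Λ, ∀ v, r • v = φ v)
    (he : ∀ j (v : (j : ι) → A ⧸ Ideal.span {h j}), e j • v = Pi.single j (v j)) {i j : ι}
    (hij : Associated (h i) (h j)) {T : Type*} [AddCommGroup T] [Module Λ T] {x : T}
    (hx : e i • x = x) (hx0 : x ≠ 0) : ∃ x' : T, e j • x' = x' ∧ x' ≠ 0 := by
  have hkill : ∀ {i j : ι} (_ : Associated (h i) (h j)), h i • cyclicGen h j = 0 := by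
    intro i j hij
    obtain ⟨c, hc⟩ := hij.symm.dvd
    rw [hc, mul_comm, mul_smul, smul_cyclicGen_self, smul_zero]
  have hmap : ∀ {i j : ι} (_ : Associated (h i) (h j)), ∃ r : Λ,
      r • cyclicGen h i = cyclicGen h j := by
    intro i j hij
    obtain ⟨r, hr⟩ := hΛ (liftTorsion (cyclicGen h j) (hkill hij) ∘ₗ LinearMap.proj i)
    refine ⟨r, ?_⟩
    rw [hr, LinearMap.comp_apply, LinearMap.proj_apply, cyclicGen_self]
    rw [← map_one (Ideal.Quotient.mk _), liftTorsion_mk, one_smul]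
  obtain ⟨r, hr⟩ := hmap hij
  obtain ⟨s, hs⟩ := hmap hij.symm
  have h1 : s * (e j * r) * e i = 1 * e i := by
    apply mul_projector_ext he
    rw [mul_smul, mul_smul, hr, projector_smul_cyclicGen he, hs, one_smul]
  refine ⟨e j • r • x, by rw [← mul_smul, projector_mul_self he], fun h0 ↦ hx0 ?_⟩
  have h2 := congrArg (· • x) h1
  simp only [one_mul, mul_smul, hx, h0, smul_zero] at h2
  exact h2.symm

theorem dvd_of_projector_smul_ne_zero [IsDomain A] [IsPrincipalIdealRing A]
    (he : ∀ j (v : (j : ι) → A ⧸ Ideal.span {h j}), e j • v = Pi.single j (v j)) {i j : ι}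
    {p : A} (hp : Irreducible p) {k : ℕ} (hi : h i = p ^ k) {T : Type*} [AddCommGroup T]
    [Module Λ T] [IsSimpleModule Λ T] {x y : T} (hx : e i • x = x) (hx0 : x ≠ 0)
    (hy : e j • y = y) (hy0 : y ≠ 0) : h i ∣ h j := by
  obtain ⟨r, hr⟩ := IsSimpleModule.toSpanSingleton_surjective Λ hx0 y
  obtain ⟨s, hs⟩ := IsSimpleModule.toSpanSingleton_surjective Λ hy0 x
  have hr : r • x = y := hr
  have hs : s • y = x := hs
  obtain ⟨a, ha⟩ := exists_projector_mul_mul_projector he i (s * e j * r)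
  have hk : p ^ k • e i = 0 := by rw [smul_projector_eq_zero_iff he, hi]
  have hax : (a • e i) • x = x := by
    rw [← ha]
    simp only [mul_smul, hx, hr, hy, hs]
  have hpa : ¬ p ∣ a := by
    intro hpa
    have h2 : p ∣ a - 1 := dvd_of_smul_eq_zero hp hk hx hx0 (by
      rw [sub_smul, sub_smul, hax, one_smul, hx, sub_self])
    have h3 := dvd_sub hpa h2
    rw [sub_sub_cancel] at h3
    exact hp.not_isUnit (isUnit_of_dvd_one h3)
  have h1 : (h j * a) • e i = 0 := by
    rw [mul_smul, ← ha, ← smul_mul_assoc, ← mul_smul_comm, ← smul_mul_assoc, ← mul_smul_comm,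
      (smul_projector_eq_zero_iff he j _).2 dvd_rfl, mul_zero, zero_mul, mul_zero, zero_mul]
  rw [smul_projector_eq_zero_iff he, hi] at h1
  rw [hi]
  exact ((hp.coprime_iff_not_dvd.2 hpa).pow_left).dvd_of_dvd_mul_right h1

/-- If `P ≅ Λ e j`, then `e i P ≅ e i Λ e j ≅ Hom (A / h j, A / h i)`. -/
theorem cornerLength_eq_length_torsionBy
    (hΛ : ∀ φ : Module.End A ((j : ι) → A ⧸ Ideal.span {h j}), ∃ r : Λ, ∀ v, r • v = φ v)
    (he : ∀ j (v : (j : ι) → A ⧸ Ideal.span {h j}), e j • v = Pi.single j (v j)) (i j : ι)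
    {P : Type*} [AddCommGroup P] [Module Λ P] {y : P} (hy : e j • y = y)
    (hgen : ∀ z : P, ∃ r : Λ, r • y = z) (hinj : ∀ r : Λ, r • y = 0 → r * e j = 0) :
    cornerLength A (e i) P =
      Module.length A (Submodule.torsionBy A (A ⧸ Ideal.span {h i}) (h j)) := by
  let _ := Module.compHom P (algebraMap A Λ)
  have hP : IsScalarTower A Λ P := ⟨fun a r x ↦ by rw [Algebra.smul_def, mul_smul]; rfl⟩
  rw [cornerLength_eq]
  have hex : ∀ z : Submodule.torsionBy A (A ⧸ Ideal.span {h i}) (h j), ∃ r : Λ,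
      r * e j = r ∧ r • cyclicGen h j = Pi.single i z.1 := by
    intro z
    have hz : h j • (Pi.single i z.1 : (j : ι) → A ⧸ Ideal.span {h j}) = 0 := by
      rw [← Pi.single_smul, (Submodule.mem_torsionBy_iff _ _).1 z.2, Pi.single_zero]
    obtain ⟨r, hr⟩ := hΛ (liftTorsion _ hz ∘ₗ LinearMap.proj j)
    have hr' : r • cyclicGen h j = Pi.single i z.1 := by
      rw [hr, LinearMap.comp_apply, LinearMap.proj_apply, cyclicGen_self]
      rw [← map_one (Ideal.Quotient.mk _), liftTorsion_mk, one_smul]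
    exact ⟨r * e j, by rw [mul_assoc, projector_mul_self he],
      by rw [mul_smul, projector_smul_cyclicGen he, hr']⟩
  choose τ hτe hτ using hex
  have hext : ∀ {r s : Λ}, r * e j = r → s * e j = s → r • cyclicGen h j = s • cyclicGen h j →
      r = s := fun hr hs hrs ↦ by rw [← hr, ← hs, mul_projector_ext he hrs]
  have hτadd : ∀ z z', τ (z + z') = τ z + τ z' := fun z z' ↦ by
    apply hext (hτe _)
    · rw [add_mul, hτe, hτe]
    · rw [add_smul, hτ, hτ, hτ, ← Pi.single_add]
      rfl
  have hτsmul : ∀ (a : A) z, τ (a • z) = a • τ z := fun a z ↦ by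
    apply hext (hτe _)
    · rw [smul_mul_assoc, hτe]
    · rw [smul_assoc, hτ, hτ, ← Pi.single_smul]
      rfl
  have heτ : ∀ z, e i * τ z = τ z := fun z ↦ by
    apply hext _ (hτe _)
    · rw [mul_smul, hτ, he, Pi.single_eq_same]
    · rw [mul_assoc, hτe]
  let G : Submodule.torsionBy A (A ⧸ Ideal.span {h i}) (h j) →ₗ[A] corner A (e i) P :=
    { toFun := fun z ↦ ⟨τ z • y, by rw [mem_corner, ← mul_smul, heτ]⟩
      map_add' := fun z z' ↦ Subtype.ext (by
        change τ (z + z') • y = τ z • y + τ z' • y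
        rw [hτadd, add_smul])
      map_smul' := fun a z ↦ Subtype.ext (by
        change τ (a • z) • y = a • τ z • y
        rw [hτsmul, smul_assoc]) }
  have hG : Function.Bijective G := by
    constructor
    · rw [injective_iff_map_eq_zero]
      intro z hz
      have h1 : τ z = 0 := by
        rw [← hτe]
        exact hinj _ (congrArg Subtype.val hz)
      have h2 := hτ z
      rw [h1, zero_smul, eq_comm, Pi.single_eq_zero_iff] at h2
      exact Subtype.ext h2
    · rintro ⟨z, hz⟩
      obtain ⟨r, rfl⟩ := hgen z
      have ht : h j • (r • cyclicGen h j) i = 0 := by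
        rw [← Pi.smul_apply, smul_comm, smul_cyclicGen_self, smul_zero, Pi.zero_apply]
      refine ⟨⟨(r • cyclicGen h j) i, (Submodule.mem_torsionBy_iff _ _).2 ht⟩, Subtype.ext ?_⟩
      change τ _ • y = r • y
      have h1 : ∀ ht', τ ⟨(r • cyclicGen h j) i, ht'⟩ = e i * r * e j := fun ht' ↦ by
        apply hext (hτe _)
        · rw [mul_assoc, projector_mul_self he]
        · rw [hτ, mul_smul, projector_smul_cyclicGen he, mul_smul, he]
      rw [h1, mul_smul, hy, mul_smul, mem_corner.1 hz]
  exact (LinearEquiv.ofBijective G hG).length_eq.symm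

end Cyclic

/-! ### Block decomposition of the Cartan determinant -/

theorem det_of_min_blocks {β : Type*} [DecidableEq β] {m : ℕ} {C : Matrix (Fin m) (Fin m) ℕ}
    {f : Fin m → β} {g : Fin m → ℕ} (hinj : ∀ i i', f i = f i' → g i = g i' → i = i')
    (hC : ∀ i k, C i k = if f i = f k then min (g i) (g k) else 0) :
    (C.map (Nat.cast : ℕ → ℤ)).det = ∏ q ∈ Finset.univ.image f,
      ((nontrivialGaps ((Finset.univ.filter (f · = q)).image g)).prod : ℤ) := by
  let E := Fintype.equivFin (Finset.univ.image f)
  let b : Fin m → Fin (Fintype.card (Finset.univ.image f)) := fun i ↦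
    E ⟨f i, Finset.mem_image_of_mem f (Finset.mem_univ i)⟩
  have hb : ∀ i (q : Finset.univ.image f), b i = E q ↔ f i = q.1 := fun i q ↦ by
    rw [E.apply_eq_iff_eq, Subtype.ext_iff]
  have htri : (C.map (Nat.cast : ℕ → ℤ)).BlockTriangular b := by
    intro i k hik
    have hne : f i ≠ f k := by
      intro h
      apply hik.ne'
      exact (hb i ⟨f k, _⟩).2 h
    rw [Matrix.map_apply, hC, if_neg hne, Nat.cast_zero]
  rw [htri.det_fintype, ← E.prod_comp, ← Finset.prod_coe_sort (Finset.univ.image f)]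
  refine Finset.prod_congr rfl fun q _ ↦ ?_
  rw [← det_min_eq]
  let G : {i // b i = E q} → (Finset.univ.filter (f · = q.1)).image g := fun i ↦
    ⟨g i.1, Finset.mem_image_of_mem g (Finset.mem_filter.2 ⟨Finset.mem_univ _, (hb _ _).1 i.2⟩)⟩
  have hG : Function.Bijective G := by
    constructor
    · intro i i' hii'
      exact Subtype.ext (hinj _ _ (((hb _ _).1 i.2).trans ((hb _ _).1 i'.2).symm)
        (congrArg Subtype.val hii'))
    · rintro ⟨t, ht⟩
      obtain ⟨i, hi, rfl⟩ := Finset.mem_image.1 ht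
      exact ⟨⟨i, (hb _ _).2 (Finset.mem_filter.1 hi).2⟩, rfl⟩
  rw [← Matrix.det_submatrix_equiv_self (Equiv.ofBijective G hG)]
  congr 1
  ext i k
  have h : f i.1 = f k.1 := ((hb _ _).1 i.2).trans ((hb _ _).1 k.2).symm
  simp [Matrix.toSquareBlock_def, hC, h, G]

/-! ### Finite global dimension and the Cartan determinant -/

section GrothendieckGroup

variable (A : Type v) {Λ : Type u} [CommRing A] [Ring Λ] [Algebra A Λ] {m : ℕ}

/-- The vector of lengths of the corners `ε k X` of a module `X`. For suitable `ε` it is the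
dimension vector of `X`, that is, the class of `X` in the Grothendieck group. -/
noncomputable def dimensionVector (ε : Fin m → Λ) (X : Type u) [AddCommGroup X] [Module Λ X] :
    Fin m → ℤ := fun k ↦ ((cornerLength A (ε k) X).toNat : ℤ)

variable {A} [IsArtinianRing Λ] {ε : Fin m → Λ} {X Y : Type u} [AddCommGroup X] [Module Λ X]
  [AddCommGroup Y] [Module Λ Y]

theorem dimensionVector_eq_add [Module.Finite Λ X] (hε : ∀ k, ε k * ε k = ε k)
    (hfin : ∀ (X : Type u) [AddCommGroup X] [Module Λ X] [Module.Finite Λ X] (k),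
      cornerLength A (ε k) X ≠ ⊤) {f : X →ₗ[Λ] Y} (hf : Function.Surjective f) :
    dimensionVector A ε X = dimensionVector A ε (LinearMap.ker f) + dimensionVector A ε Y := by
  ext k
  have hY : Module.Finite Λ Y := Module.Finite.of_surjective f hf
  simp only [dimensionVector, Pi.add_apply]
  rw [cornerLength_add A (hε k) (LinearMap.ker f),
    cornerLength_congr A (f.quotKerEquivOfSurjective hf), ENat.toNat_add (hfin _ k) (hfin _ k),
    Nat.cast_add]

variable {T P : Fin m → ModuleCat.{u} Λ} {π : ∀ i, P i →ₗ[Λ] T i}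

/-- The dimension vector of a finitely generated projective module is a sum of dimension vectors
of the projective covers, since a projective cover can be split off. -/
theorem dimensionVector_mem_span_of_projective
    (hTc : ∀ X : ModuleCat.{u} Λ, IsSimpleModule Λ X → ∃ i, Nonempty (X ≃ₗ[Λ] T i))
    (hπ : ∀ i, IsProjectiveCover (π i)) (hTs : ∀ i, IsSimpleModule Λ (T i))
    (hε : ∀ k, ε k * ε k = ε k)
    (hfin : ∀ (X : Type u) [AddCommGroup X] [Module Λ X] [Module.Finite Λ X] (k),
      cornerLength A (ε k) X ≠ ⊤) (n : ℕ) (X : Type u) [AddCommGroup X] [Module Λ X]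
    [Module.Finite Λ X] [Module.Projective Λ X] (hn : Module.length Λ X ≤ n) :
    dimensionVector A ε X ∈ Submodule.span ℤ (Set.range fun i ↦ dimensionVector A ε (P i)) := by
  induction n generalizing X with
  | zero =>
    have : Subsingleton X := Module.length_eq_zero_iff.1 (by simpa using hn)
    have h0 : dimensionVector A ε X = 0 := by
      ext k
      simp [dimensionVector, cornerLength_of_subsingleton]
    rw [h0]
    exact Submodule.zero_mem _
  | succ n ih =>
    rcases subsingleton_or_nontrivial X with hX | hX
    · exact ih X (by rw [Module.length_eq_zero]; exact zero_le)
    obtain ⟨N, hN⟩ := IsCoatomic.exists_coatom (Submodule Λ X)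
    obtain ⟨i, ⟨E⟩⟩ := hTc (ModuleCat.of Λ (X ⧸ N)) (isSimpleModule_iff_isCoatom.2 hN)
    let g : X →ₗ[Λ] T i := E.toLinearMap ∘ₗ N.mkQ
    have hg : Function.Surjective g := E.surjective.comp N.mkQ_surjective
    obtain ⟨f, hf⟩ := Module.projective_lifting_property (π i) g (hπ i).surjective
    have hfs : Function.Surjective f := by
      rw [← LinearMap.range_eq_top]
      apply (hπ i).superfluous
      rw [eq_top_iff]
      intro z _
      obtain ⟨x, hx⟩ := hg (π i z)
      rw [← hf, LinearMap.comp_apply] at hx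
      rw [← add_sub_cancel (f x) z]
      refine Submodule.add_mem_sup ⟨x, rfl⟩ ?_
      rw [LinearMap.mem_ker, map_sub, hx, sub_self]
    have := (hπ i).projective
    obtain ⟨s, hs⟩ := Module.projective_lifting_property f LinearMap.id hfs
    have hfsx : ∀ z, f (s z) = z := fun z ↦ LinearMap.congr_fun hs z
    let r : X →ₗ[Λ] LinearMap.ker f := (LinearMap.id - s ∘ₗ f).codRestrict _ fun x ↦ by
      simp [hfsx]
    have hproj : Module.Projective Λ (LinearMap.ker f) :=
      Module.Projective.of_split (LinearMap.ker f).subtype r (by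
        ext ⟨x, hx⟩
        have hx : f x = 0 := hx
        simp [r, hx])
    have hPi : Nontrivial (P i) := by
      have := (hTs i).nontrivial
      exact (hπ i).surjective.nontrivial
    have hker : LinearMap.ker f ≠ ⊤ := by
      intro htop
      obtain ⟨z, hz⟩ := exists_ne (0 : P i)
      obtain ⟨x, rfl⟩ := hfs z
      exact hz (LinearMap.mem_ker.1 (htop ▸ Submodule.mem_top))
    rw [dimensionVector_eq_add hε hfin hfs]
    refine Submodule.add_mem _ (ih _ ?_) (Submodule.subset_span ⟨i, rfl⟩)
    exact Order.le_of_lt_add_one ((Submodule.length_lt hker).trans_le (by exact_mod_cast hn))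

theorem dimensionVector_mem_span_of_hasProjectiveDimensionLT
    (hTc : ∀ X : ModuleCat.{u} Λ, IsSimpleModule Λ X → ∃ i, Nonempty (X ≃ₗ[Λ] T i))
    (hπ : ∀ i, IsProjectiveCover (π i)) (hTs : ∀ i, IsSimpleModule Λ (T i))
    (hε : ∀ k, ε k * ε k = ε k)
    (hfin : ∀ (X : Type u) [AddCommGroup X] [Module Λ X] [Module.Finite Λ X] (k),
      cornerLength A (ε k) X ≠ ⊤) (n : ℕ) (X : Type u) [AddCommGroup X] [Module Λ X]
    [Module.Finite Λ X]
    (hn : CategoryTheory.HasProjectiveDimensionLT (ModuleCat.of Λ X) (n + 1)) :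
    dimensionVector A ε X ∈ Submodule.span ℤ (Set.range fun i ↦ dimensionVector A ε (P i)) := by
  have hproj : ∀ (X : Type u) [AddCommGroup X] [Module Λ X] [Module.Finite Λ X]
      [Module.Projective Λ X], dimensionVector A ε X ∈
        Submodule.span ℤ (Set.range fun i ↦ dimensionVector A ε (P i)) := fun X _ _ _ _ ↦ by
    obtain ⟨l, hl⟩ := ENat.ne_top_iff_exists.1 (Module.length_ne_top (R := Λ) (M := X))
    exact dimensionVector_mem_span_of_projective hTc hπ hTs hε hfin l X hl.ge
  induction n generalizing X with
  | zero =>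
    have := hasProjectiveDimensionLT_one_iff.1 hn
    exact hproj X
  | succ n ih =>
    obtain ⟨b, f, hf⟩ := Module.Finite.exists_fin' Λ X
    have h1 := dimensionVector_eq_add hε hfin hf
    rw [← sub_eq_iff_eq_add'] at h1
    rw [← h1]
    exact Submodule.sub_mem _ (hproj _) (ih _ ((hasProjectiveDimensionLT_iff_ker hf n).1 hn))

/-- If the global dimension is finite, then the dimension vectors of the simple modules, which are
the unit vectors, are integral combinations of the rows of the Cartan matrix. -/
theorem isUnit_det_of_globalDimension_lt_top {C : Matrix (Fin m) (Fin m) ℕ}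
    (hTc : ∀ X : ModuleCat.{u} Λ, IsSimpleModule Λ X → ∃ i, Nonempty (X ≃ₗ[Λ] T i))
    (hπ : ∀ i, IsProjectiveCover (π i)) (hTs : ∀ i, IsSimpleModule Λ (T i))
    (hε : ∀ k, ε k * ε k = ε k)
    (hfin : ∀ (X : Type u) [AddCommGroup X] [Module Λ X] [Module.Finite Λ X] (k),
      cornerLength A (ε k) X ≠ ⊤)
    (hT : ∀ i k, cornerLength A (ε k) (T i) = if i = k then 1 else 0)
    (hC : ∀ i k, cornerLength A (ε k) (P i) = C i k) (hgl : globalDimension Λ < ⊤) :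
    IsUnit (C.map (Nat.cast : ℕ → ℤ)).det := by
  have hP : ∀ i, dimensionVector A ε (P i) = C.map (Nat.cast : ℕ → ℤ) i := fun i ↦ by
    ext k
    simp [dimensionVector, hC]
  have hmem : ∀ i, ∃ c : Fin m → ℤ,
      ∑ l, c l • C.map (Nat.cast : ℕ → ℤ) l = dimensionVector A ε (T i) := by
    intro i
    have hTf : Module.Finite Λ (T i) := inferInstance
    have hpd : CategoryTheory.projectiveDimension (T i) < ⊤ :=
      (le_iSup₂ (f := fun (M : ModuleCat.{u} Λ) (_ : Module.Finite Λ M) ↦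
        CategoryTheory.projectiveDimension M) (T i) hTf).trans_lt hgl
    obtain ⟨n, hn⟩ := (CategoryTheory.projectiveDimension_ne_top_iff _).1 hpd.ne
    have h1 := dimensionVector_mem_span_of_hasProjectiveDimensionLT hTc hπ hTs hε hfin n (T i) hn
    simp only [hP] at h1
    exact (Submodule.mem_span_range_iff_exists_fun ℤ).1 h1
  choose B hB using hmem
  refine Matrix.isUnit_det_of_left_inverse (B := Matrix.of B) ?_
  ext i k
  have h1 := congrFun (hB i) k
  rw [Finset.sum_apply] at h1
  rw [Matrix.mul_apply, Matrix.one_apply]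
  simp only [Matrix.of_apply]
  simp only [Pi.smul_apply, smul_eq_mul] at h1
  rw [h1, dimensionVector, hT]
  split_ifs <;> simp

end GrothendieckGroup

/-! ### The Cartan matrix of the endomorphism algebra of a sum of primary cyclic modules -/

section Cartan

variable {A : Type v} [CommRing A] [IsDomain A] [IsPrincipalIdealRing A] {Λ : Type u} [Ring Λ]
  [Algebra A Λ] {ι : Type w} [Fintype ι] [DecidableEq ι] {h : ι → A}
  [Module Λ ((j : ι) → A ⧸ Ideal.span {h j})] [IsScalarTower A Λ ((j : ι) → A ⧸ Ideal.span {h j})]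
  [FaithfulSMul Λ ((j : ι) → A ⧸ Ideal.span {h j})] {p : ι → A} {k : ι → ℕ}

/-- The simple modules correspond to the distinct primary divisors `h j`, and the Cartan numbers
are the lengths of the homomorphism modules between the corresponding cyclic modules. -/
theorem exists_index_of_isCartanMatrix [IsArtinianRing Λ]
    (hΛ : ∀ φ : Module.End A ((j : ι) → A ⧸ Ideal.span {h j}), ∃ r : Λ, ∀ v, r • v = φ v)
    (hp : ∀ j, Irreducible (p j)) (hk : ∀ j, 1 ≤ k j) (hh : ∀ j, h j = p j ^ k j) {m : ℕ}
    {C : Matrix (Fin m) (Fin m) ℕ} (hC : IsCartanMatrix Λ C) :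
    ∃ σ : Fin m → ι, (∀ i i', Associated (h (σ i)) (h (σ i')) → i = i') ∧
      (∀ j, ∃ i, Associated (h (σ i)) (h j)) ∧
      (∀ i l, (C i l : ℕ∞) =
        Module.length A (Submodule.torsionBy A (A ⧸ Ideal.span {h (σ l)}) (h (σ i)))) ∧
      (globalDimension Λ < ⊤ → IsUnit (C.map (Nat.cast : ℕ → ℤ)).det) := by
  obtain ⟨T, P, π, hTs, hTi, hTc, hπ, hM⟩ := hC
  choose e he using fun j ↦ hΛ (LinearMap.single A (fun j ↦ A ⧸ Ideal.span {h j}) j ∘ₗ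
    LinearMap.proj j)
  have he : ∀ j (v : (j : ι) → A ⧸ Ideal.span {h j}), e j • v = Pi.single j (v j) := he
  have hkill : ∀ j, p j ^ k j • e j = 0 := fun j ↦ by rw [smul_projector_eq_zero_iff he, hh]
  have hid := projector_mul_self he
  have hloc := exists_projector_mul_mul_projector he
  choose σ x hx hx0 using fun i ↦
    have := (hTs i).nontrivial
    exists_projector_smul_ne_zero he (T i)
  choose y hy hgen hinj using fun i ↦
    (hπ i).exists_generator (hid (σ i)) (hloc (σ i)) (hp _) (hkill _) (hx i) (hx0 i)
  have hmult : ∀ (X : Type u) [AddCommGroup X] [Module Λ X] (l : Fin m) (c : ℕ),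
      HasMultiplicity Λ X (T l) c → cornerLength A (e (σ l)) X = c := by
    intro X _ _ l c hc
    exact hc.cornerLength_eq A (hid _) (hloc _) (hx l) (hx0 l) fun N N' hs z hz hz0 ↦
      nonempty_linearEquiv_of_corner (hloc _) (hp _) (hkill _) hz hz0 (hx l) (hx0 l)
  have hPC : ∀ i l, cornerLength A (e (σ l)) (P i) = C i l := fun i l ↦ hmult _ l _ (hM i l)
  refine ⟨σ, fun i i' hii' ↦ ?_, fun j ↦ ?_, fun i l ↦ ?_, fun hgl ↦ ?_⟩
  · obtain ⟨x', hx', hx0'⟩ :=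
      exists_projector_smul_ne_zero_of_associated hΛ he hii' (hx i) (hx0 i)
    exact hTi _ _ (nonempty_linearEquiv_of_corner (hloc _) (hp _) (hkill _) hx' hx0' (hx i')
      (hx0 i'))
  · obtain ⟨M, hs, z, hz, hz0⟩ := exists_simple_of_projector he j (by
      rw [hh, isUnit_pow_iff (by have := hk j; omega)]
      exact (hp j).not_isUnit)
    obtain ⟨i, ⟨E⟩⟩ := hTc (ModuleCat.of Λ (Λ ⧸ M)) hs
    have hEz : e j • E z = E z := by rw [← map_smul]; exact congrArg E hz
    have hEz0 : E z ≠ 0 := by rwa [Ne, LinearEquiv.map_eq_zero_iff]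
    exact ⟨i, associated_of_dvd_dvd
      (dvd_of_projector_smul_ne_zero he (hp _) (hh _) (hx i) (hx0 i) hEz hEz0)
      (dvd_of_projector_smul_ne_zero he (hp _) (hh _) hEz hEz0 (hx i) (hx0 i))⟩
  · rw [← hPC, cornerLength_eq_length_torsionBy hΛ he (σ l) (σ i) (hy i) (hgen i) (hinj i)]
  · refine isUnit_det_of_globalDimension_lt_top (A := A) (ε := fun l ↦ e (σ l)) hTc hπ hTs
      (fun l ↦ hid _) (fun X _ _ _ l ↦ ?_) (fun i l ↦ ?_) hPC hgl
    · obtain ⟨s, h0, h1⟩ := exists_compositionSeries_of_isNoetherian_isArtinian Λ X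
      rw [hmult X l _ ⟨s, h0, h1, rfl⟩]
      exact ENat.natCast_ne_top _
    · split_ifs with hil
      · subst hil
        exact cornerLength_eq_one A (hloc _) (hx i) (hx0 i)
      · refine cornerLength_eq_zero A fun z hz ↦ ?_
        by_contra hz0
        exact hil (hTi _ _ (nonempty_linearEquiv_of_corner (hloc _) (hp _) (hkill _) hz hz0 (hx l)
          (hx0 l)))

/-- The Cartan determinant as a product over the primes `q` of the products of the gaps of the set
of exponents of `q`. -/
theorem det_eq_prod_of_isCartanMatrix [IsArtinianRing Λ] [DecidableEq A]
    (hΛ : ∀ φ : Module.End A ((j : ι) → A ⧸ Ideal.span {h j}), ∃ r : Λ, ∀ v, r • v = φ v)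
    (hp : ∀ j, Irreducible (p j)) (hk : ∀ j, 1 ≤ k j) (hh : ∀ j, h j = p j ^ k j)
    (hnorm : ∀ i j, Associated (p i) (p j) → p i = p j) {m : ℕ}
    {C : Matrix (Fin m) (Fin m) ℕ} (hC : IsCartanMatrix Λ C) :
    (C.map (Nat.cast : ℕ → ℤ)).det = ∏ q ∈ Finset.univ.image p,
      ((nontrivialGaps ((Finset.univ.filter (p · = q)).image k)).prod : ℤ) ∧
      (globalDimension Λ < ⊤ → IsUnit (C.map (Nat.cast : ℕ → ℤ)).det) := by
  obtain ⟨σ, h1, h2, h3, h4⟩ := exists_index_of_isCartanMatrix hΛ hp hk hh hC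
  refine ⟨?_, h4⟩
  have hassoc : ∀ i j, Associated (h i) (h j) → p i = p j ∧ k i = k j := by
    intro i j hij
    rw [hh, hh] at hij
    have hpi : p i = p j := hnorm i j (((hp i).associated_of_dvd (hp j)) <|
      (hp i).prime.dvd_of_dvd_pow ((dvd_pow_self _ (by have := hk i; omega)).trans hij.dvd))
    rw [hpi] at hij
    exact ⟨hpi, (pow_dvd_pow_iff (hp j).ne_zero (hp j).not_isUnit).1 hij.dvd |>.antisymm
      ((pow_dvd_pow_iff (hp j).ne_zero (hp j).not_isUnit).1 hij.symm.dvd)⟩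
  rw [det_of_min_blocks (f := fun i ↦ p (σ i)) (g := fun i ↦ k (σ i)) (fun i i' hf hg ↦ h1 i i' ?_)
    fun i l ↦ ?_]
  · have himage : Finset.univ.image (fun i ↦ p (σ i)) = Finset.univ.image p := by
      ext q
      simp only [Finset.mem_image, Finset.mem_univ, true_and]
      constructor
      · rintro ⟨i, rfl⟩
        exact ⟨σ i, rfl⟩
      · rintro ⟨j, rfl⟩
        obtain ⟨i, hi⟩ := h2 j
        exact ⟨i, (hassoc _ _ hi).1⟩
    rw [himage]
    refine Finset.prod_congr rfl fun q _ ↦ ?_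
    congr 3
    ext t
    simp only [Finset.mem_image, Finset.mem_filter, Finset.mem_univ, true_and]
    constructor
    · rintro ⟨i, hi, rfl⟩
      exact ⟨σ i, hi, rfl⟩
    · rintro ⟨j, rfl, rfl⟩
      obtain ⟨i, hi⟩ := h2 j
      exact ⟨i, (hassoc _ _ hi).1, (hassoc _ _ hi).2⟩
  · rw [hh, hh]
    rw [hf, hg]
  · have h5 := h3 i l
    split_ifs with hil
    · rw [hh (σ l), hh (σ i), hil, length_torsionBy_pow (hp _)] at h5
      exact_mod_cast h5
    · have hcop : IsCoprime (h (σ i)) (h (σ l)) := by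
        rw [hh, hh]
        refine IsCoprime.pow (((hp _).coprime_iff_not_dvd).2 fun hdvd ↦ hil ?_)
        exact hnorm _ _ ((hp _).associated_of_dvd (hp _) hdvd)
      rw [length_torsionBy_of_isCoprime hcop] at h5
      exact_mod_cast h5

/-- If the exponents of the prime `f` have a gap at `t`, then the endomorphism algebra is not
quasi-hereditary. -/
theorem not_isQuasiHereditary_of_gap
    (hp : ∀ j, Irreducible (p j)) (hh : ∀ j, h j = p j ^ k j) {f : A} (hf : Irreducible f)
    (hnorm : ∀ j, Associated f (p j) → p j = f) {t : ℕ} (ht : 0 < t)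
    (hgap : ∀ j, p j = f → k j ≠ t) (hex : ∃ j, p j = f ∧ t < k j) : ¬ IsQuasiHereditary Λ := by
  classical
  intro hQ
  -- `a` is nilpotent and divisible by `f` exactly once; `s` kills the other primary components
  -- and multiplies the `f`-primary component by `f ^ (t - 1)`, up to a unit.
  let b : A := ∏ j with p j ≠ f, p j
  let K : ℕ := ∑ j, k j
  let s : A := f ^ (t - 1) * b ^ K
  have hkK : ∀ j, k j ≤ K := fun j ↦ Finset.single_le_sum (fun _ _ ↦ zero_le) (Finset.mem_univ j)
  have hb : ∀ j, p j ≠ f → p j ∣ b := fun j hj ↦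
    Finset.dvd_prod_of_mem p (Finset.mem_filter.2 ⟨Finset.mem_univ j, hj⟩)
  have hfb : IsCoprime f b := IsCoprime.prod_right fun j hj ↦
    hf.coprime_iff_not_dvd.2 fun hdvd ↦
      (Finset.mem_filter.1 hj).2 (hnorm j (hf.associated_of_dvd (hp j) hdvd))
  have hpow : ∀ j, p j ≠ f → h j ∣ b ^ K := fun j hj ↦ by
    rw [hh]
    exact (pow_dvd_pow _ (hkK j)).trans (pow_dvd_pow_of_dvd (hb j hj) K)
  have hsmul : ∀ (a c : A) (j : ι), a • (Ideal.Quotient.mk (Ideal.span {h j}) c) =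
      Ideal.Quotient.mk _ (a * c) := fun _ _ _ ↦ rfl
  have hnil : IsNilpotent (algebraMap A Λ (f * b)) := by
    refine ⟨K, ?_⟩
    rw [← map_pow]
    refine FaithfulSMul.eq_of_smul_eq_smul (α := (j : ι) → A ⧸ Ideal.span {h j}) fun v ↦ ?_
    rw [zero_smul, algebraMap_smul]
    funext j
    obtain ⟨c, hc⟩ := Ideal.Quotient.mk_surjective (v j)
    rw [Pi.smul_apply, ← hc, hsmul, Pi.zero_apply, Ideal.Quotient.eq_zero_iff_dvd]
    refine Dvd.dvd.mul_right ?_ c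
    rw [mul_pow]
    by_cases hj : p j = f
    · refine Dvd.dvd.mul_right ?_ _
      rw [hh, hj]
      exact pow_dvd_pow _ (hkK j)
    · exact (hpow j hj).mul_left _
  have hs := algebraMap_eq_zero_of_isQuasiHereditary (V := (j : ι) → A ⧸ Ideal.span {h j})
    (s := s) hnil (fun x hx ↦ ?_) hQ
  · obtain ⟨j, hj, hkj⟩ := hex
    have h1 : s • cyclicGen h j = 0 := by
      rw [← algebraMap_smul Λ, hs, zero_smul]
    have h2 := congrFun h1 j
    rw [Pi.smul_apply, cyclicGen_self, ← map_one (Ideal.Quotient.mk _), hsmul, mul_one,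
      Pi.zero_apply, Ideal.Quotient.eq_zero_iff_dvd, hh, hj] at h2
    have h3 := (IsCoprime.pow hfb).dvd_of_dvd_mul_right h2
    rw [pow_dvd_pow_iff hf.ne_zero hf.not_isUnit] at h3
    omega
  · have key : ∀ j, ∃ d : A, s • x j = ((f * b) * s) • Ideal.Quotient.mk _ d := by
      intro j
      obtain ⟨c, hc⟩ := Ideal.Quotient.mk_surjective (x j)
      have hxj := congrFun hx j
      rw [Pi.smul_apply, ← hc, hsmul, Pi.zero_apply, Ideal.Quotient.eq_zero_iff_dvd] at hxj
      have hzero : h j ∣ s * c → ∃ d : A, s • x j = ((f * b) * s) • Ideal.Quotient.mk _ d := by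
        intro hdvd
        refine ⟨0, ?_⟩
        rw [← hc, hsmul, hsmul, mul_zero, map_zero, Ideal.Quotient.eq_zero_iff_dvd]
        exact hdvd
      by_cases hj : p j = f
      · rw [hh, hj] at hxj
        have h1 : f ^ k j ∣ f ^ t * c := by
          refine (IsCoprime.pow_right (n := K + 1) (IsCoprime.pow_left hfb)).dvd_of_dvd_mul_right
            (z := b ^ (K + 1)) ?_
          refine hxj.trans (dvd_of_eq ?_)
          obtain ⟨t', rfl⟩ : ∃ t', t = t' + 1 := ⟨t - 1, by omega⟩
          simp only [s, Nat.add_sub_cancel]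
          ring
        rcases lt_or_gt_of_ne (hgap j hj) with hlt | hgt
        · refine hzero ?_
          rw [hh, hj]
          refine Dvd.dvd.mul_right (Dvd.dvd.mul_right (pow_dvd_pow f (by omega)) _) _
        · have h2 : f ∣ c := by
            have h3 : f ^ t * f ∣ f ^ t * c := by
              rw [← pow_succ]
              exact (pow_dvd_pow f hgt).trans h1
            exact (mul_dvd_mul_iff_left (pow_ne_zero _ hf.ne_zero)).1 h3
          obtain ⟨c', rfl⟩ := h2
          obtain ⟨u, b', hub⟩ := hfb.pow_left (m := k j)
          refine ⟨b' * c', ?_⟩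
          rw [← hc, hsmul, hsmul, Ideal.Quotient.eq, Ideal.mem_span_singleton, hh, hj]
          refine ⟨u * s * f * c', ?_⟩
          linear_combination (-1 : A) * s * f * c' * hub
      · exact hzero ((hpow j hj).trans ((dvd_mul_left _ _).mul_right c))
    choose d hd using key
    exact ⟨fun j ↦ Ideal.Quotient.mk _ (d j), funext hd⟩

end Cartan

/-! ### Centralizers as endomorphism algebras -/

section Centralizer

variable {R : Type u} [Field R] {n : ℕ}

theorem mem_centralizerAlgebra {c x : Matrix (Fin n) (Fin n) R} :
    x ∈ centralizerAlgebra c ↔ c * x = x * c := by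
  simp [centralizerAlgebra, Subalgebra.mem_centralizer_iff]

/-- The action of the centralizer of `c` on the `R[X]`-module `Rⁿ`, where `X` acts as `c`. -/
noncomputable def centralizerToEnd (c : Matrix (Fin n) (Fin n) R) :
    centralizerAlgebra c →+* Module.End R[X] (Module.AEval' (Matrix.toLin' c)) where
  toFun s := LinearMap.ofAEval (Matrix.toLin' c)
    ((Module.AEval.of R (Fin n → R) (Matrix.toLin' c)).toLinearMap ∘ₗ Matrix.toLin' s.1)
    fun v ↦ by
      have h := mem_centralizerAlgebra.1 s.2
      simp only [LinearMap.comp_apply, LinearEquiv.coe_coe, Module.AEval.X_smul_of]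
      congr 1
      change s.1.mulVec (c.mulVec v) = c.mulVec (s.1.mulVec v)
      rw [Matrix.mulVec_mulVec, Matrix.mulVec_mulVec, h]
  map_one' := LinearMap.ext fun v ↦ Matrix.one_mulVec (α := R) (m := Fin n) v
  map_mul' s t := LinearMap.ext fun v ↦ (Matrix.mulVec_mulVec (α := R) (m := Fin n) v s.1 t.1).symm
  map_zero' := LinearMap.ext fun v ↦ Matrix.zero_mulVec (α := R) (m := Fin n) v
  map_add' s t := LinearMap.ext fun v ↦ Matrix.add_mulVec (α := R) (m := Fin n) s.1 t.1 v

theorem centralizerToEnd_apply_of (c : Matrix (Fin n) (Fin n) R) (s : centralizerAlgebra c)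
    (v : Fin n → R) : centralizerToEnd c s (Module.AEval.of R _ (Matrix.toLin' c) v) =
      Module.AEval.of R _ (Matrix.toLin' c) (s.1.mulVec v) := rfl

theorem centralizerToEnd_bijective (c : Matrix (Fin n) (Fin n) R) :
    Function.Bijective (centralizerToEnd c) := by
  constructor
  · intro s t hst
    refine Subtype.ext (Matrix.toLin'.injective (LinearMap.ext fun v ↦ ?_))
    exact LinearMap.congr_fun hst (Module.AEval.of R _ (Matrix.toLin' c) v)
  · intro φ
    let O := Module.AEval.of R (Fin n → R) (Matrix.toLin' c)
    let g : (Fin n → R) →ₗ[R] (Fin n → R) :=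
      O.symm.toLinearMap ∘ₗ (φ.restrictScalars R) ∘ₗ O.toLinearMap
    have hg : ∀ v, O (g v) = φ (O v) := fun v ↦ O.apply_symm_apply _
    have hcomm : Matrix.toLin' c ∘ₗ g = g ∘ₗ Matrix.toLin' c := by
      refine LinearMap.ext fun v ↦ O.injective ?_
      have h1 := Module.AEval.X_smul_of (R := R) (Matrix.toLin' c) (g v)
      have h2 := Module.AEval.X_smul_of (R := R) (Matrix.toLin' c) v
      change O (Matrix.toLin' c • g v) = O (g (Matrix.toLin' c • v))
      have h3 : (X : R[X]) • O (g v) = O (g (Matrix.toLin' c • v)) := by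
        rw [hg, hg, ← map_smul]
        exact congrArg φ h2
      exact h1.symm.trans h3
    have hmem : LinearMap.toMatrix' g ∈ centralizerAlgebra c := by
      rw [mem_centralizerAlgebra]
      apply Matrix.toLin'.injective
      rw [Matrix.toLin'_mul, Matrix.toLin'_mul, Matrix.toLin'_toMatrix', hcomm]
    refine ⟨⟨_, hmem⟩, LinearMap.ext fun v ↦ ?_⟩
    obtain ⟨v, rfl⟩ := O.surjective v
    rw [← hg]
    change O (Matrix.toLin' (LinearMap.toMatrix' g) v) = O (g v)
    rw [Matrix.toLin'_toMatrix']

/-- The matrix `c` as an element of its centralizer. -/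
def centralizerGen (c : Matrix (Fin n) (Fin n) R) : centralizerAlgebra c :=
  ⟨c, mem_centralizerAlgebra.2 rfl⟩

theorem centralizerToEnd_aeval (c : Matrix (Fin n) (Fin n) R) (q : R[X])
    (v : Module.AEval' (Matrix.toLin' c)) :
    centralizerToEnd c (aeval (centralizerGen c) q) v = q • v := by
  obtain ⟨v, rfl⟩ := (Module.AEval.of R _ (Matrix.toLin' c)).surjective v
  have h1 : Matrix.toLin' (aeval (centralizerGen c) q).1 = aeval (Matrix.toLin' c) q := by
    rw [Polynomial.aeval_subalgebra_coe]
    exact (Polynomial.aeval_algHom_apply (Matrix.toLinAlgEquiv' : _ ≃ₐ[R] _).toAlgHom c q).symm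
  rw [centralizerToEnd_apply_of, ← Module.AEval.of_aeval_smul, ← h1]
  rfl

theorem commute_aeval_centralizerGen (c : Matrix (Fin n) (Fin n) R) (q : R[X])
    (s : centralizerAlgebra c) :
    aeval (centralizerGen c) q * s = s * aeval (centralizerGen c) q := by
  apply (centralizerToEnd_bijective c).1
  ext v
  simp only [map_mul, Module.End.mul_apply, centralizerToEnd_aeval, map_smul]

end Centralizer

/-! ### Power indices and maximal elementary divisors -/

section Divisors

variable {R : Type u} [Field R] {n : ℕ} {c : Matrix (Fin n) (Fin n) R} {r : ℕ}
  {p : Fin r → R[X]} {k : Fin r → ℕ}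

theorem mem_powerIndices_iff (hp : ∀ i, (p i).Monic ∧ Irreducible (p i) ∧ 1 ≤ k i)
    (hE : elementaryDivisors c = Finset.univ.val.map fun i ↦ p i ^ k i) {f : R[X]}
    (hfm : f.Monic) (hf : Irreducible f) {t : ℕ} :
    t ∈ powerIndices c f ↔ ∃ j, p j = f ∧ k j = t := by
  simp only [powerIndices, Set.Finite.mem_toFinset, Set.mem_ofPred_eq]
  constructor
  · rintro ⟨ht, q, hq, hqf, hmem⟩
    rw [hE, Multiset.mem_map] at hmem
    obtain ⟨j, -, hj⟩ := hmem
    have hqf' : Associated q f := hq.associated_of_dvd hf hqf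
    have hpj : p j = f := by
      refine eq_of_monic_of_associated (hp j).1 hfm (((hp j).2.1.associated_of_dvd hq ?_).trans hqf')
      refine (hp j).2.1.prime.dvd_of_dvd_pow (n := t) ?_
      rw [← hj]
      exact dvd_pow_self _ (by have := (hp j).2.2; omega)
    refine ⟨j, hpj, ?_⟩
    have hdeg : (p j).natDegree = q.natDegree :=
      natDegree_eq_of_degree_eq (by rw [hpj]; exact degree_eq_degree_of_associated hqf'.symm)
    have h1 := congrArg natDegree hj
    rw [natDegree_pow, natDegree_pow, hdeg] at h1
    exact Nat.eq_of_mul_eq_mul_right hq.natDegree_pos h1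
  · rintro ⟨j, rfl, rfl⟩
    refine ⟨(hp j).2.2, p j, hf, dvd_rfl, ?_⟩
    rw [hE, Multiset.mem_map]
    exact ⟨j, Finset.mem_univ_val j, rfl⟩

theorem powerIndices_pos {f : R[X]} {t : ℕ} (ht : t ∈ powerIndices c f) : 0 < t := by
  simp only [powerIndices, Set.Finite.mem_toFinset, Set.mem_ofPred_eq] at ht
  exact ht.1

theorem eq_of_pow_dvd_pow (hp : ∀ i, (p i).Monic ∧ Irreducible (p i) ∧ 1 ≤ k i) {i j : Fin r}
    (h : p i ^ k i ∣ p j ^ k j) : p i = p j ∧ k i ≤ k j := by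
  have hpij : p i = p j := eq_of_monic_of_associated (hp i).1 (hp j).1
    ((hp i).2.1.associated_of_dvd (hp j).2.1 ((hp i).2.1.prime.dvd_of_dvd_pow
      ((dvd_pow_self _ (by have := (hp i).2.2; omega)).trans h)))
  rw [hpij] at h
  exact ⟨hpij, (pow_dvd_pow_iff (hp j).2.1.ne_zero (hp j).2.1.not_isUnit).1 h⟩

/-- Every irreducible factor has a power that is a maximal elementary divisor. -/
theorem exists_pow_mem_maximalDivisors (hp : ∀ i, (p i).Monic ∧ Irreducible (p i) ∧ 1 ≤ k i)
    (hE : elementaryDivisors c = Finset.univ.val.map fun i ↦ p i ^ k i) (j : Fin r) :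
    ∃ i, p i = p j ∧ p i ^ k i ∈ maximalDivisors c := by
  classical
  obtain ⟨i, hi, hmax⟩ := Finset.exists_max_image (Finset.univ.filter (p · = p j)) k
    ⟨j, by simp⟩
  rw [Finset.mem_filter] at hi
  refine ⟨i, hi.2, ?_, ?_⟩
  · rw [hE, Multiset.mem_map]
    exact ⟨i, Finset.mem_univ_val i, rfl⟩
  · intro g hg hdvd
    rw [hE, Multiset.mem_map] at hg
    obtain ⟨l, -, rfl⟩ := hg
    obtain ⟨h1, h2⟩ := eq_of_pow_dvd_pow hp hdvd
    have h3 := hmax l (Finset.mem_filter.2 ⟨Finset.mem_univ l, h1.symm.trans hi.2⟩)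
    rw [h1, le_antisymm h2 h3]

theorem mem_irregularFactors_iff (hp : ∀ i, (p i).Monic ∧ Irreducible (p i) ∧ 1 ≤ k i)
    (hE : elementaryDivisors c = Finset.univ.val.map fun i ↦ p i ^ k i) {f : R[X]} :
    f ∈ irregularFactors c ↔ ∃ j, p j = f ∧
      (powerIndices c f).card ≠ (powerIndices c f).sup id := by
  constructor
  · rintro ⟨hm, hf, i, hi, hne⟩
    have hmem := hi.1
    rw [hE, Multiset.mem_map] at hmem
    obtain ⟨j, -, hj⟩ := hmem
    have hjf : p j = f := eq_of_monic_of_associated (hp j).1 hm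
      ((hp j).2.1.associated_of_dvd hf ((hp j).2.1.prime.dvd_of_dvd_pow (n := i) (by
        rw [← hj]
        exact dvd_pow_self _ (by have := (hp j).2.2; omega))))
    refine ⟨j, hjf, ?_⟩
    have hi0 : i ≠ 0 := by
      rintro rfl
      rw [pow_zero] at hj
      exact (hp j).2.1.not_isUnit
        ((isUnit_pow_iff (by have := (hp j).2.2; omega)).1 (hj ▸ isUnit_one))
    rwa [powerIndices_pow c f hi0] at hne
  · rintro ⟨j, rfl, hne⟩
    obtain ⟨i, hij, hi⟩ := exists_pow_mem_maximalDivisors hp hE j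
    refine ⟨(hp j).1, (hp j).2.1, k i, hij ▸ hi, ?_⟩
    rwa [powerIndices_pow c _ (by have := (hp i).2.2; omega)]

theorem forall_maximalDivisors_iff (hp : ∀ i, (p i).Monic ∧ Irreducible (p i) ∧ 1 ≤ k i)
    (hE : elementaryDivisors c = Finset.univ.val.map fun i ↦ p i ^ k i) :
    (∀ f ∈ maximalDivisors c, (powerIndices c f).card = (powerIndices c f).sup id) ↔
      ∀ j, (powerIndices c (p j)).card = (powerIndices c (p j)).sup id := by
  have hk : ∀ i, k i ≠ 0 := fun i ↦ by have := (hp i).2.2; omega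
  constructor
  · intro h j
    obtain ⟨i, hij, hi⟩ := exists_pow_mem_maximalDivisors hp hE j
    have h1 := h _ hi
    rwa [powerIndices_pow c _ (hk i), hij] at h1
  · intro h f hf
    have hmem := hf.1
    rw [hE, Multiset.mem_map] at hmem
    obtain ⟨j, -, rfl⟩ := hmem
    rw [powerIndices_pow c _ (hk j)]
    exact h j

end Divisors

end CentralizerAlg

theorem lemma5p5 {R : Type u} [Field R] (n : ℕ) (c : Matrix (Fin n) (Fin n) R)
    (m : ℕ) (C : Matrix (Fin m) (Fin m) ℕ) (hC : IsCartanMatrix (centralizerAlgebra c) C) :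
    ((irregularFactors c ≠ ∅ →
        (C.map (Nat.cast : ℕ → ℤ)).det =
          ∏ f ∈ (finite_irregularFactors c).toFinset,
            ((nontrivialGaps (powerIndices c f)).prod : ℤ)) ∧
      (irregularFactors c = ∅ → (C.map (Nat.cast : ℕ → ℤ)).det = 1)) ∧
    List.TFAE [
      IsQuasiHereditary (centralizerAlgebra c),
      globalDimension (centralizerAlgebra c) < ⊤,
      globalDimension (centralizerAlgebra c) ≤ 2,
      irregularFactors c = ∅,
      ∀ f ∈ maximalDivisors c, (powerIndices c f).card = (powerIndices c f).sup id,
      (C.map (Nat.cast : ℕ → ℤ)).det = 1] := by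
  classical
  obtain ⟨r, p, k, hp, ⟨E⟩, hE⟩ := hasElementaryDivisors c
  have hart : IsArtinianRing (centralizerAlgebra c) := IsArtinianRing.of_finite R _
  have hpow := fun j ↦ @mem_powerIndices_iff R _ n c r p k hp hE (p j) (hp j).1 (hp j).2.1
  -- The centralizer is the endomorphism algebra of the sum of the `R[X] / (p j ^ k j)`.
  let h : Fin r → R[X] := fun j ↦ p j ^ k j
  let ρ : centralizerAlgebra c →+* Module.End R[X] ((j : Fin r) → R[X] ⧸ Ideal.span {h j}) :=
    E.conjRingEquiv.toRingHom.comp (centralizerToEnd c)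
  have hρ : Function.Bijective ρ := E.conjRingEquiv.bijective.comp (centralizerToEnd_bijective c)
  let _ : Module (centralizerAlgebra c) ((j : Fin r) → R[X] ⧸ Ideal.span {h j}) :=
    Module.compHom _ ρ
  have hsmul : ∀ (s : centralizerAlgebra c) (v : (j : Fin r) → R[X] ⧸ Ideal.span {h j}),
      s • v = ρ s v := fun _ _ ↦ rfl
  let _ : Algebra R[X] (centralizerAlgebra c) :=
    (aeval (centralizerGen c)).toRingHom.toAlgebra' (commute_aeval_centralizerGen c)
  have hact : ∀ (q : R[X]) (v : (j : Fin r) → R[X] ⧸ Ideal.span {h j}),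
      algebraMap R[X] (centralizerAlgebra c) q • v = q • v := by
    intro q v
    change E (centralizerToEnd c (aeval (centralizerGen c) q) (E.symm v)) = q • v
    rw [centralizerToEnd_aeval, map_smul, LinearEquiv.apply_symm_apply]
  have htower : IsScalarTower R[X] (centralizerAlgebra c)
      ((j : Fin r) → R[X] ⧸ Ideal.span {h j}) :=
    ⟨fun q s v ↦ by rw [Algebra.smul_def, mul_smul, hact]⟩
  have hfaith : FaithfulSMul (centralizerAlgebra c) ((j : Fin r) → R[X] ⧸ Ideal.span {h j}) :=
    ⟨fun hst ↦ hρ.1 (LinearMap.ext hst)⟩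
  have hΛ : ∀ φ : Module.End R[X] ((j : Fin r) → R[X] ⧸ Ideal.span {h j}),
      ∃ s : centralizerAlgebra c, ∀ v, s • v = φ v := fun φ ↦ by
    obtain ⟨s, hs⟩ := hρ.2 φ
    exact ⟨s, fun v ↦ by rw [hsmul, hs]⟩
  -- The determinant formula.
  obtain ⟨hdet, hunit⟩ := det_eq_prod_of_isCartanMatrix hΛ (fun j ↦ (hp j).2.1)
    (fun j ↦ (hp j).2.2) (fun j ↦ rfl)
    (fun i j hij ↦ eq_of_monic_of_associated (hp i).1 (hp j).1 hij) hC
  have hdet : (C.map (Nat.cast : ℕ → ℤ)).det =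
      ∏ q ∈ Finset.univ.image p, ((nontrivialGaps (powerIndices c q)).prod : ℤ) := by
    rw [hdet]
    refine Finset.prod_congr rfl fun q hq ↦ ?_
    obtain ⟨j, -, rfl⟩ := Finset.mem_image.1 hq
    congr 3
    ext t
    rw [hpow]
    simp [and_comm]
  have hone : ∀ q, (nontrivialGaps (powerIndices c q)).prod = 1 ↔
      (powerIndices c q).card = (powerIndices c q).sup id := fun q ↦
    prod_nontrivialGaps_eq_one_iff fun t ht ↦ powerIndices_pos ht
  have hdet' : (C.map (Nat.cast : ℕ → ℤ)).det = ∏ f ∈ (finite_irregularFactors c).toFinset,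
      ((nontrivialGaps (powerIndices c f)).prod : ℤ) := by
    rw [hdet]
    refine (Finset.prod_subset (fun f hf ↦ ?_) fun f hf hf' ↦ ?_).symm
    · rw [Set.Finite.mem_toFinset, mem_irregularFactors_iff hp hE] at hf
      obtain ⟨j, hj, -⟩ := hf
      exact Finset.mem_image.2 ⟨j, Finset.mem_univ j, hj⟩
    · rw [Set.Finite.mem_toFinset, mem_irregularFactors_iff hp hE] at hf'
      obtain ⟨j, -, hj⟩ := Finset.mem_image.1 hf
      push Not at hf'
      exact_mod_cast (hone f).2 (hf' j hj)
  have hempty : irregularFactors c = ∅ → (C.map (Nat.cast : ℕ → ℤ)).det = 1 := fun h0 ↦ by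
    rw [hdet']
    simp [h0]
  have hreg : irregularFactors c = ∅ ↔
      ∀ j, (powerIndices c (p j)).card = (powerIndices c (p j)).sup id := by
    rw [Set.eq_empty_iff_forall_notMem]
    simp only [mem_irregularFactors_iff hp hE]
    constructor
    · intro h1 j
      by_contra hne
      exact h1 (p j) ⟨j, rfl, hne⟩
    · rintro h1 _ ⟨j, rfl, hne⟩
      exact hne (h1 j)
  -- If there are no gaps, every prime power dividing an elementary divisor is one.
  have hH : irregularFactors c = ∅ → ∀ q, Prime q → ∀ l, 1 ≤ l → ∀ i, q ^ l ∣ h i →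
      ∃ j, Associated (h j) (q ^ l) := by
    intro h0 q hq l hl i hqi
    have hqp : Associated q (p i) := hq.irreducible.associated_of_dvd (hp i).2.1
      (hq.dvd_of_dvd_pow ((dvd_pow_self q (by omega)).trans hqi))
    have hli : l ≤ k i := by
      rw [(hqp.pow_pow (n := l)).dvd_iff_dvd_left] at hqi
      exact (pow_dvd_pow_iff (hp i).2.1.ne_zero (hp i).2.1.not_isUnit).1 hqi
    have hmem : l ∈ powerIndices c (p i) := by
      rw [eq_Icc_of_card_eq_sup (fun t ht ↦ powerIndices_pos ht) (hreg.1 h0 i), Finset.mem_Icc]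
      exact ⟨hl, hli.trans (Finset.le_sup (f := id) ((hpow i).2 ⟨i, rfl, rfl⟩))⟩
    obtain ⟨j, hj, rfl⟩ := (hpow i).1 hmem
    exact ⟨j, by rw [show h j = p i ^ k j by rw [← hj]]; exact hqp.symm.pow_pow⟩
  have hne : ∀ j, h j ≠ 0 := fun j ↦ pow_ne_zero _ (hp j).2.1.ne_zero
  refine ⟨⟨fun _ ↦ hdet', hempty⟩, ?_⟩
  tfae_have 1 → 4 := by
    intro hQ
    rw [hreg]
    intro j
    by_contra hne'
    obtain ⟨t, ht, htT, l, hl, htl⟩ := exists_gap_of_card_ne_sup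
      (fun t ht ↦ powerIndices_pos ht) hne'
    obtain ⟨i, hi, rfl⟩ := (hpow j).1 hl
    exact not_isQuasiHereditary_of_gap (fun j ↦ (hp j).2.1) (fun j ↦ rfl) (hp j).2.1
      (fun i hij ↦ eq_of_monic_of_associated (hp i).1 (hp j).1 hij.symm) ht
      (fun i hij hit ↦ htT ((hpow j).2 ⟨i, hij, hit⟩)) ⟨i, hi, htl⟩ hQ
  tfae_have 4 → 1 := fun h0 ↦ isQuasiHereditary_of_forall_associated hΛ hne (hH h0)
  tfae_have 4 → 3 := fun h0 ↦ globalDimension_le_two_of_forall_associated hΛ hne (hH h0)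
  tfae_have 3 → 2 := fun h2 ↦ h2.trans_lt (WithBot.coe_lt_coe.2 (ENat.natCast_lt_top 2))
  tfae_have 2 → 6 := by
    intro hgl
    have hpos : 0 < (C.map (Nat.cast : ℕ → ℤ)).det := by
      rw [hdet]
      refine Finset.prod_pos fun q _ ↦ ?_
      exact_mod_cast prod_nontrivialGaps_pos fun t ht ↦ powerIndices_pos ht
    rcases Int.isUnit_iff.1 (hunit hgl) with h1 | h1
    · exact h1
    · omega
  tfae_have 6 → 4 := by
    intro h1
    rw [hreg]
    intro j
    rw [← hone]
    have h2 : ∏ q ∈ Finset.univ.image p, (nontrivialGaps (powerIndices c q)).prod = 1 := by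
      exact_mod_cast hdet.symm.trans h1
    exact Finset.prod_eq_one_iff.1 h2 _ (Finset.mem_image_of_mem p (Finset.mem_univ j))
  tfae_have 4 ↔ 5 := by rw [hreg, forall_maximalDivisors_iff hp hE]
  tfae_finish
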